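/- Let $n\ge 1$, let $\ell_1,\dots,\ell_{n-1}>0$ and $0<\ell_n^-<\ell_n^+$ be real numbers, and put $\ell^\pm=(\ell_1,\dots,\ell_{n-1},\ell_n^\pm)$ and $A=\{(\ell_1,\dots,\ell_{n-1},t):\ \ell_n^-\le t\le \ell_n^+\}\subset\mathbf R^n$. Let $F:\mathbf C^n\to\mathbf R^n$ be the map $F(z_1,\dots,z_n)=(|z_2-z_1|,|z_3-z_2|,\dots,|z_n-z_{n-1}|,|z_1-z_n|)$, let $E(2)$ be the group of orientation preserving isometries of $\mathbf C$, acting diagonally on $\mathbf C^n$, and let $$M_{\ell^-}=F^{-1}(\ell^-)/E(2),\qquad M_A=F^{-1}(A)/E(2),$$ with the quotient topology and the quotient smooth structure: a real function on an open subset of $M_{\ell^-}$ or $M_A$ is smooth if and only if its pull-back to the corresponding subset of $F^{-1}(\ell^-)$ or $F^{-1}(A)$ in $\mathbf C^n$ is smooth. Suppose that $A$ is generic, i.e. $\sum_{j=1}^n\epsilon_j\ell_j^-\ne 0$ and $\sum_{j=1}^n\epsilon_j\ell_j^+\neq 0$ for all $\epsilon_1,\dots,\epsilon_n\in\{1,-1\}$,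 and that $$\ell_n^+-\ell_n^-<[\ell^-],$$ where $[\ell^-]$ denotes the smallest nonnegative value of $\sum_{i=1}^n\epsilon_i\ell_i^-$ with $\epsilon_i=\pm1$. Then $M_{\ell^-}$ is a smooth manifold of dimension $n-3$, $M_A$ is a smooth manifold with boundary of dimension $n-2$ (both are empty if $n\le 2$), and $M_A$ is diffeomorphic to the Cartesian product $M_{\ell^-}\times[0,1]$. -/

import Mathlib

open Set Topology
open scoped Manifold ContDiff

/-- An isometry `g` of the plane `ℂ` preserves the orientation, i.e. it is an element of `E(2)`. -/
def IsProperMotion (g : ℂ ≃ᵃⁱ[ℝ] ℂ) : Prop :=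
  0 < LinearMap.det (g.linearIsometryEquiv.toLinearEquiv : ℂ →ₗ[ℝ] ℂ)

/-- The map `F : ℂⁿ → ℝⁿ`, `F(z)ᵢ = |zᵢ₊₁ - zᵢ|`, for `n = m + 1`. The addition `i + 1` in
`Fin (m + 1)` is cyclic, so that the successor of the last index is `0`. -/
noncomputable def sideLengths {m : ℕ} (z : Fin (m + 1) → ℂ) : Fin (m + 1) → ℝ :=
  fun i => ‖z (i + 1) - z i‖

/-- The configurations `F⁻¹(A)`. -/
def configSet {m : ℕ} (A : Set (Fin (m + 1) → ℝ)) : Set (Fin (m + 1) → ℂ) :=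
  sideLengths ⁻¹' A

/-- Two configurations are equivalent if they lie in one orbit of the diagonal action of `E(2)`. -/
def configSetoid {m : ℕ} (A : Set (Fin (m + 1) → ℝ)) : Setoid (configSet A) where
  r z w := ∃ g : ℂ ≃ᵃⁱ[ℝ] ℂ, IsProperMotion g ∧ ∀ i, w.1 i = g (z.1 i)
  iseqv :=
    { refl := fun z => ⟨1, by
        have h : ((AffineIsometryEquiv.linearIsometryEquiv (1 : ℂ ≃ᵃⁱ[ℝ] ℂ)).toLinearEquiv :
            ℂ →ₗ[ℝ] ℂ) = LinearMap.id := by ext x; rfl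
        simp [IsProperMotion, h], fun i => rfl⟩
      symm := by
        rintro z w ⟨g, hg, h⟩
        refine ⟨g.symm, ?_, fun i => by rw [h i]; simp⟩
        have e : ((g.symm.linearIsometryEquiv).toLinearEquiv : ℂ →ₗ[ℝ] ℂ)
            = (g.linearIsometryEquiv.toLinearEquiv.symm : ℂ →ₗ[ℝ] ℂ) := rfl
        have k := LinearEquiv.det_mul_det_symm g.linearIsometryEquiv.toLinearEquiv
        unfold IsProperMotion at hg ⊢
        rw [e]
        by_contra hc
        push Not at hc
        nlinarith
      trans := by
        rintro z w v ⟨g, hg, h⟩ ⟨g', hg', h'⟩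
        refine ⟨g.trans g', ?_, fun i => by rw [h' i, h i]; rfl⟩
        have e : (((g.trans g').linearIsometryEquiv).toLinearEquiv : ℂ →ₗ[ℝ] ℂ)
            = (g'.linearIsometryEquiv.toLinearEquiv : ℂ →ₗ[ℝ] ℂ) ∘ₗ
              (g.linearIsometryEquiv.toLinearEquiv : ℂ →ₗ[ℝ] ℂ) := rfl
        unfold IsProperMotion at hg hg' ⊢
        rw [e, LinearMap.det_comp]
        exact mul_pos hg' hg }

/-- The moduli space `M_A = F⁻¹(A) / E(2)`. -/
def ModuliSpace {m : ℕ} (A : Set (Fin (m + 1) → ℝ)) : Type :=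
  Quotient (configSetoid A)

/-- The quotient topology. -/
instance {m : ℕ} (A : Set (Fin (m + 1) → ℝ)) : TopologicalSpace (ModuliSpace A) :=
  inferInstanceAs (TopologicalSpace (Quotient (configSetoid A)))

/-- The projection `F⁻¹(A) → M_A`. -/
def ModuliSpace.mk {m : ℕ} (A : Set (Fin (m + 1) → ℝ)) (z : configSet A) : ModuliSpace A :=
  Quotient.mk (configSetoid A) z

/-- The pull-back of `f : M_A → ℝ` to the part of `F⁻¹(A)` over `U` is smooth, as a function on
that subset of `ℂⁿ = ℝ²ⁿ`. Smoothness on a subset is meant as for smooth functions on a half-space,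
i.e. with derivatives within the subset; on a submanifold (with boundary) of `ℂⁿ` this is smoothness
in the usual sense. The values of the auxiliary `g` outside of the subset play no role. -/
def ModuliSpace.PullbackSmoothOn {m : ℕ} {A : Set (Fin (m + 1) → ℝ)}
    (f : ModuliSpace A → ℝ) (U : Set (ModuliSpace A)) : Prop :=
  ∃ g : (Fin (m + 1) → ℂ) → ℝ,
    ContDiffOn ℝ ∞ g (Subtype.val '' (mk A ⁻¹' U)) ∧
      ∀ w : configSet A, mk A w ∈ U → g w.1 = f (mk A w)

/-- An atlas on `M_A` (with model `I`) makes `M_A` a smooth manifold, and its smooth structure is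
the standard one on the quotient of `F⁻¹(A) ⊆ ℂⁿ` by `E(2)`: a real function on an open subset of
`M_A` is smooth if and only if its pull-back to `F⁻¹(A)` is. As a smooth structure is determined
by its smooth functions, at most one smooth structure on the space `M_A` has this property. -/
structure ModuliSpace.IsQuotientManifold {m : ℕ} (A : Set (Fin (m + 1) → ℝ))
    {E : Type*} [NormedAddCommGroup E] [NormedSpace ℝ E] {H : Type*} [TopologicalSpace H]
    (I : ModelWithCorners ℝ E H) [ChartedSpace H (ModuliSpace A)] : Prop where
  isManifold : IsManifold I ∞ (ModuliSpace A)
  contMDiffOn_iff : ∀ U : Set (ModuliSpace A), IsOpen U → ∀ f : ModuliSpace A → ℝ,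
    ContMDiffOn I 𝓘(ℝ, ℝ) ∞ f U ↔ PullbackSmoothOn f U

/-- The vector `ε` consists of signs `±1`. -/
def IsSignVector {m : ℕ} (ε : Fin (m + 1) → ℝ) : Prop :=
  ∀ i, ε i = 1 ∨ ε i = -1

/-- A length vector is generic if `∑ εⱼ ℓⱼ ≠ 0` for all signs `εⱼ = ±1`. -/
def IsGenericVector {m : ℕ} (ℓ : Fin (m + 1) → ℝ) : Prop :=
  ∀ ε : Fin (m + 1) → ℝ, IsSignVector ε → ∑ j, ε j * ℓ j ≠ 0

/-- The set of the nonnegative values of `∑ εᵢ ℓᵢ`, with `εᵢ = ±1`. -/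
def nonnegSignedSums {m : ℕ} (ℓ : Fin (m + 1) → ℝ) : Set ℝ :=
  {s | 0 ≤ s ∧ ∃ ε : Fin (m + 1) → ℝ, IsSignVector ε ∧ s = ∑ i, ε i * ℓ i}

/-- The number `[ℓ]`: the smallest nonnegative value of `∑ εᵢ ℓᵢ`. -/
noncomputable def bracket {m : ℕ} (ℓ : Fin (m + 1) → ℝ) : ℝ :=
  sInf (nonnegSignedSums ℓ)

/-- The minimum in the definition of `[ℓ]` is attained. -/
theorem bracket_isLeast {m : ℕ} (ℓ : Fin (m + 1) → ℝ) :
    IsLeast (nonnegSignedSums ℓ) (bracket ℓ) := by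
  have hne : (nonnegSignedSums ℓ).Nonempty := by
    rcases le_total 0 (∑ i, ℓ i) with h | h
    · exact ⟨_, h, fun _ => 1, fun _ => Or.inl rfl, by simp⟩
    · exact ⟨_, neg_nonneg.mpr h, fun _ => -1, fun _ => Or.inr rfl, by simp⟩
  have hfin : (nonnegSignedSums ℓ).Finite := by
    have h1 : (Set.pi Set.univ (fun _ : Fin (m + 1) => ({1, -1} : Set ℝ))).Finite :=
      Set.Finite.pi' (fun _ => Set.toFinite _) |>.subset (fun x hx i => hx i (Set.mem_univ i))
    refine (h1.image (fun ε => ∑ i, ε i * ℓ i)).subset ?_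
    rintro s ⟨-, ε, hε, rfl⟩
    exact ⟨ε, fun i _ => hε i, rfl⟩
  exact ⟨hne.csInf_mem hfin, fun s hs => csInf_le hfin.bddBelow hs⟩

/-- The length vector `(ℓ₁, …, ℓₘ, t)` with `n = m + 1` entries. -/
def lengthVector {m : ℕ} (ℓ : Fin m → ℝ) (t : ℝ) : Fin (m + 1) → ℝ :=
  Fin.snoc (α := fun _ => ℝ) ℓ t

/-- The metric data `A` of a telescopic linkage: the interval of length vectors between
`ℓ⁻ = (ℓ₁, …, ℓₘ, a)` and `ℓ⁺ = (ℓ₁, …, ℓₘ, b)`. -/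
def telescopicData {m : ℕ} (ℓ : Fin m → ℝ) (a b : ℝ) : Set (Fin (m + 1) → ℝ) :=
  {x | ∀ j, lengthVector ℓ a j ≤ x j ∧ x j ≤ lengthVector ℓ b j}

/-! A polygon up to translation is the list of its side directions `u i` on the unit circle, and it
closes up exactly when the center of mass of these points, weighted by the lengths, is the origin.
The proof moves the points by automorphisms of the unit disc. If no point of the circle carries half
of the total weight or more (`IsStableConfig`), some automorphism brings the center of mass to the
origin, and it is unique up to a rotation (`exists_sum_discAut_eq_zero`,
`DiscEquiv.exists_rotation`). The point of the disc to be moved to the origin, the conformal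
barycenter, depends smoothly on weights and points, by the implicit function theorem
(`contDiffOn_conformalBarycenter`).

Varying the last length `t` in `[a, b]` changes every signed sum of lengths by at most `b - a`,
which is less than the bracket, so no signed sum changes sign. Hence directions that close up for
one `s` in `[a, b]` are stable for every `t` in `[a, b]` (`isStableConfig_of_closed`). Rebalancing
therefore turns a closed polygon with last length `t` into one with last length `a` and back. The
two operations are inverse up to a motion, because closed stable configurations in one disc orbit
differ by a rotation.

To work with a manifold instead of a quotient, the last direction is rotated to `-1`. The other
directions then form an arm from `0` to `a`, a point of `armDirections ℓ a`. This space is a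
manifold of dimension `m - 2`: by genericity two legs are never parallel to each other, and they are
recovered smoothly from the remaining ones as sides of a triangle
(`exists_chartedSpace_armDirections`). The maps `normalDirections` and `armConfig` identify the two
moduli spaces with `armDirections ℓ a` and `armDirections ℓ a × [0, 1]`. Both structures are
transported along these identifications, and a smooth section makes them the quotient structures
(`ModuliSpace.exists_isQuotientManifold_of_section`). -/

/-! ### Transported manifold structures and quotients with a smooth section -/

/-- The charted space structure transported along a homeomorphism. -/
@[reducible]
def Homeomorph.transportChartedSpace {M X H : Type*} [TopologicalSpace M] [TopologicalSpace X]
    [TopologicalSpace H] [ChartedSpace H X] (h : M ≃ₜ X) : ChartedSpace H M where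
  atlas := (fun c => h.toOpenPartialHomeomorph.trans c) '' atlas H X
  chartAt x := h.toOpenPartialHomeomorph.trans (chartAt H (h x))
  mem_chart_source x := by simp
  chart_mem_atlas x := ⟨_, chart_mem_atlas H (h x), rfl⟩

section Transport

variable {M X E H : Type*} [TopologicalSpace M] [TopologicalSpace X]
  [NormedAddCommGroup E] [NormedSpace ℝ E] [TopologicalSpace H] [ChartedSpace H X]
  (I : ModelWithCorners ℝ E H) (h : M ≃ₜ X)

/-- In a change of charts the factors `h.symm` and `h` cancel, so the transition maps are those of
`X`. -/
theorem Homeomorph.isManifold_transport [IsManifold I ∞ X] :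
    letI := h.transportChartedSpace (H := H)
    IsManifold I ∞ M := by
  let _ := h.transportChartedSpace (H := H)
  have : HasGroupoid M (contDiffGroupoid ∞ I) := by
    refine ⟨?_⟩
    rintro _ _ ⟨c, hc, rfl⟩ ⟨c', hc', rfl⟩
    have e : (h.toOpenPartialHomeomorph.trans c).symm.trans
        (h.toOpenPartialHomeomorph.trans c') = c.symm.trans c' := by
      rw [OpenPartialHomeomorph.trans_symm_eq_symm_trans_symm, OpenPartialHomeomorph.trans_assoc,
        ← OpenPartialHomeomorph.trans_assoc _ _ c', ← Homeomorph.symm_toOpenPartialHomeomorph,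
        ← Homeomorph.trans_toOpenPartialHomeomorph]
      simp
    rw [e]
    exact StructureGroupoid.compatible _ hc hc'
  exact IsManifold.mk' I ∞ M

/-- Read in a chart of `X` and its transport, `h` is the identity. -/
theorem Homeomorph.contMDiff_transport :
    letI := h.transportChartedSpace (H := H)
    ContMDiff I I ∞ h := by
  let _ := h.transportChartedSpace (H := H)
  intro x
  rw [contMDiffAt_iff]
  refine ⟨h.continuous.continuousAt, ?_⟩
  have hx : ∀ᶠ y in 𝓝[range I] (extChartAt I (h x) (h x)),
      (extChartAt I (h x) ∘ h ∘ (extChartAt I x).symm) y = y := by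
    filter_upwards [extChartAt_target_mem_nhdsWithin (I := I) (h x)] with y hy
    have : (extChartAt I x).symm y = h.symm ((extChartAt I (h x)).symm y) := by
      simp [extChartAt, chartAt]
      rfl
    simp only [Function.comp, this, Homeomorph.apply_symm_apply]
    exact (extChartAt I (h x)).right_inv hy
  have hp : extChartAt I x x = extChartAt I (h x) (h x) := by
    simp [extChartAt, chartAt]
    rfl
  rw [hp]
  exact contDiffWithinAt_id.congr_of_eventuallyEq hx
    (hx.self_of_nhdsWithin (by simp [extChartAt]))

theorem Homeomorph.contMDiff_symm_transport :
    letI := h.transportChartedSpace (H := H)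
    ContMDiff I I ∞ h.symm := by
  let _ := h.transportChartedSpace (H := H)
  intro y
  obtain ⟨x, rfl⟩ := h.surjective y
  rw [contMDiffAt_iff]
  refine ⟨h.symm.continuous.continuousAt, ?_⟩
  have hx : ∀ᶠ y in 𝓝[range I] (extChartAt I (h x) (h x)),
      (extChartAt I (h.symm (h x)) ∘ h.symm ∘ (extChartAt I (h x)).symm) y = y := by
    rw [h.symm_apply_apply]
    filter_upwards [extChartAt_target_mem_nhdsWithin (I := I) (h x)] with y hy
    have : ∀ z, extChartAt I x (h.symm z) = extChartAt I (h x) z := by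
      intro z
      obtain ⟨z, rfl⟩ := h.surjective z
      rw [h.symm_apply_apply]
      simp [extChartAt, chartAt]
      rfl
    simp only [Function.comp, this]
    exact (extChartAt I (h x)).right_inv hy
  exact contDiffWithinAt_id.congr_of_eventuallyEq hx
    (hx.self_of_nhdsWithin (by simp [extChartAt]))

end Transport

/-- If `X` is a manifold, `Q` a smooth map from the configurations to `X` whose fibres are the
orbits, and `R` a smooth section of `Q`, then the moduli space is a manifold diffeomorphic to `X`.
-/
theorem ModuliSpace.exists_isQuotientManifold_of_section {m : ℕ} (A : Set (Fin (m + 1) → ℝ))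
    {E H X : Type*} [NormedAddCommGroup E] [NormedSpace ℝ E] [TopologicalSpace H]
    (I : ModelWithCorners ℝ E H) [TopologicalSpace X] [ChartedSpace H X] [IsManifold I ∞ X]
    (Q : (Fin (m + 1) → ℂ) → X) (R : X → Fin (m + 1) → ℂ)
    (hQ : ContMDiffOn 𝓘(ℝ, Fin (m + 1) → ℂ) I ∞ Q (configSet A))
    (hR : ContMDiff I 𝓘(ℝ, Fin (m + 1) → ℂ) ∞ R)
    (hRA : ∀ x, R x ∈ configSet A)
    (hinv : ∀ z w : configSet A, configSetoid A z w → Q z.1 = Q w.1)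
    (hQR : ∀ x, Q (R x) = x)
    (hRQ : ∀ z : configSet A, configSetoid A ⟨R (Q z.1), hRA _⟩ z) :
    ∃ _ : ChartedSpace H (ModuliSpace A), ModuliSpace.IsQuotientManifold A I ∧
      Nonempty (ModuliSpace A ≃ₘ^∞⟮I, I⟯ X) := by
  let q : ModuliSpace A → X := Quotient.lift (fun z : configSet A => Q z.1) hinv
  have hq : ∀ z, q (mk A z) = Q z.1 := fun z => rfl
  let r : X → ModuliSpace A := fun x => mk A ⟨R x, hRA x⟩
  have hmk : Continuous (mk A) := continuous_quotient_mk'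
  have hrq : ∀ z : configSet A, r (Q z.1) = mk A z := fun z => Quotient.sound (hRQ z)
  let h : ModuliSpace A ≃ₜ X :=
    { toFun := q
      invFun := r
      left_inv := fun p => by
        induction p using Quotient.inductionOn with
        | h z => exact hrq z
      right_inv := fun x => hQR x
      continuous_toFun := Continuous.quotient_lift
        (continuousOn_iff_continuous_domRestrict.1 hQ.continuousOn) hinv
      continuous_invFun := hmk.comp (hR.continuous.subtype_mk _) }
  let _ := h.transportChartedSpace (H := H)
  have hs : ContMDiff I I ∞ q := h.contMDiff_transport I
  have hs' : ContMDiff I I ∞ r := h.contMDiff_symm_transport I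
  refine ⟨inferInstance, ⟨h.isManifold_transport I, fun U hU f => ⟨fun hf => ?_, ?_⟩⟩,
    ⟨⟨h.toEquiv, hs, hs'⟩⟩⟩
  -- The pull-back extends to the ambient space through `Q`.
  · refine ⟨fun z => f (r (Q z)), ?_, fun w _ => congrArg f (hrq w)⟩
    rw [← contMDiffOn_iff_contDiffOn]
    refine hf.comp (hs'.comp_contMDiffOn (hQ.mono ?_)) ?_
    · rintro _ ⟨z, -, rfl⟩
      exact z.2
    · rintro _ ⟨z, hz, rfl⟩
      simpa [hrq] using hz
  · rintro ⟨g, hg, hgf⟩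
    have hqr : ∀ p, mk A ⟨R (q p), hRA _⟩ = p := fun p => h.left_inv p
    -- Conversely, `f` is recovered by restricting its pull-back to the section.
    have : ContMDiffOn I 𝓘(ℝ, ℝ) ∞ (fun p => g (R (q p))) U := by
      refine (contMDiffOn_iff_contDiffOn.2 hg).comp (hR.comp hs).contMDiffOn ?_
      intro p hp
      refine ⟨⟨R (q p), hRA _⟩, ?_, rfl⟩
      rw [mem_preimage, hqr]
      exact hp
    refine this.congr fun p hp => ?_
    have := hgf ⟨R (q p), hRA _⟩ (by rw [hqr]; exact hp)
    rw [this, hqr]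

/-! ### Embedded manifolds from local charts -/

section Embedded

variable {V E : Type*} [NormedAddCommGroup V] [NormedSpace ℝ V] [NormedAddCommGroup E]
  [NormedSpace ℝ E]

/-- A subset of a normed space with smooth local charts is a manifold, with a smooth inclusion,
and smooth maps into the subset are smooth maps into the manifold. -/
theorem exists_chartedSpace_of_local_charts (N : Set V)
    (hN : ∀ p : N, ∃ φ : OpenPartialHomeomorph N E, p ∈ φ.source ∧
      (∃ c : V → E, ContDiffOn ℝ ∞ c (Subtype.val '' φ.source) ∧ ∀ x ∈ φ.source, c x.1 = φ x) ∧
      ContDiffOn ℝ ∞ (fun y => (φ.symm y).1) φ.target) :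
    ∃ _ : ChartedSpace E N, IsManifold 𝓘(ℝ, E) ∞ N ∧
      ContMDiff 𝓘(ℝ, E) 𝓘(ℝ, V) ∞ (Subtype.val : N → V) ∧
      ∀ ρ : V → N, (∀ x : N, ρ x.1 = x) → ContMDiffOn 𝓘(ℝ, V) 𝓘(ℝ, E) ∞ ρ N := by
  choose φ hφ using hN
  have hp := fun p => (hφ p).1
  have hs := fun p => (hφ p).2.2
  choose c hcc using fun p => (hφ p).2.1
  have hc := fun p => (hcc p).1
  have hcφ := fun p => (hcc p).2
  let _ : ChartedSpace E N :=
    { atlas := range φ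
      chartAt := φ
      mem_chart_source := hp
      chart_mem_atlas := fun p => ⟨p, rfl⟩ }
  have hch : ∀ p : N, chartAt E p = φ p := fun p => rfl
  have hV : ∀ v : V, chartAt V v = OpenPartialHomeomorph.refl V := fun _ => rfl
  have hM : IsManifold 𝓘(ℝ, E) ∞ N := by
    apply isManifold_of_contDiffOn
    rintro _ _ ⟨p, rfl⟩ ⟨p', rfl⟩
    simp only [modelWithCornersSelf_coe, modelWithCornersSelf_coe_symm, Function.id_comp,
      Function.comp_id, preimage_id, range_id, inter_univ]
    have : ContDiffOn ℝ ∞ (fun y => c p' ((φ p).symm y).1) ((φ p).symm.trans (φ p')).source := by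
      refine (hc p').comp ((hs p).mono ?_) ?_
      · intro y hy
        simpa using hy.1
      · intro y hy
        simp only [OpenPartialHomeomorph.trans_source, mem_inter_iff, mem_preimage] at hy
        exact ⟨_, hy.2, rfl⟩
    refine this.congr fun y hy => ?_
    simp only [OpenPartialHomeomorph.trans_source, mem_inter_iff, mem_preimage] at hy
    simp [hcφ _ _ hy.2]
  refine ⟨inferInstance, hM, ?_, fun ρ hρ => ?_⟩
  · intro p
    rw [contMDiffAt_iff]
    refine ⟨continuous_subtype_val.continuousAt, ?_⟩
    have h1 := (hs p).contDiffAt ((φ p).open_target.mem_nhds ((φ p).map_source (hp p)))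
    simpa [extChartAt, hch, hV, Function.comp_def] using h1.contDiffWithinAt (s := univ)
  · have hcont : ContinuousOn ρ N := by
      rw [continuousOn_iff_continuous_domRestrict]
      convert continuous_id (X := N) using 1
      funext x
      exact hρ x
    intro x hx
    have hx' : ρ x = ⟨x, hx⟩ := hρ ⟨x, hx⟩
    rw [contMDiffWithinAt_iff]
    refine ⟨hcont x hx, ?_⟩
    simp only [extChartAt, hch, hV, mfld_simps]
    have h1 : ContDiffWithinAt ℝ ∞ (c (ρ x)) N x := by
      have h2 := hc (ρ x) x ⟨ρ x, hp _, by rw [hx']⟩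
      refine h2.mono_of_mem_nhdsWithin ?_
      have h3 := (φ (ρ x)).open_source.mem_nhds (hp (ρ x))
      have h4 := hcont.continuousWithinAt hx h3
      filter_upwards [h4, self_mem_nhdsWithin] with y hy hyN
      exact ⟨ρ y, hy, by rw [hρ ⟨y, hyN⟩]⟩
    refine h1.congr_of_eventuallyEq ?_ ?_
    · have h3 := (φ (ρ x)).open_source.mem_nhds (hp (ρ x))
      filter_upwards [hcont.continuousWithinAt hx h3, self_mem_nhdsWithin] with y hy hyN
      have := hcφ (ρ x) (ρ y) hy
      rw [hρ ⟨y, hyN⟩] at this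
      simp only [Function.comp, hρ ⟨y, hyN⟩]
      exact this.symm
    · have := hcφ (ρ x) (ρ x) (hp _)
      simp only [Function.comp]
      rw [← this, hx']

end Embedded

/-! ### Disc automorphisms acting on the unit circle -/

open ComplexConjugate in
/-- The automorphism `u ↦ (u - w) / (1 - w̄ u)` of the unit disc. -/
noncomputable def discAut (w u : ℂ) : ℂ := (u - w) / (1 - conj w * u)

section DiscAut

open ComplexConjugate

theorem Complex.mul_conj_of_norm_eq_one {u : ℂ} (hu : ‖u‖ = 1) : u * conj u = 1 := by
  rw [Complex.mul_conj, Complex.normSq_eq_norm_sq, hu]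
  simp

theorem Complex.one_sub_conj_mul_ne_zero {w u : ℂ} (hw : ‖w‖ < 1) (hu : ‖u‖ ≤ 1) :
    1 - conj w * u ≠ 0 := by
  intro h
  have h1 : ‖conj w * u‖ = 1 := by rw [← sub_eq_zero.1 h]; simp
  rw [norm_mul, RCLike.norm_conj] at h1
  nlinarith [norm_nonneg w, norm_nonneg u]

/-- On the circle the conjugate is the inverse. This gives numerator and denominator of `discAut`
equal modulus. -/
theorem Complex.one_sub_conj_mul_eq {w u : ℂ} (hu : ‖u‖ = 1) :
    1 - conj w * u = u * conj (u - w) := by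
  rw [map_sub, mul_sub, Complex.mul_conj_of_norm_eq_one hu]
  ring

theorem norm_discAut {w u : ℂ} (hw : ‖w‖ < 1) (hu : ‖u‖ = 1) : ‖discAut w u‖ = 1 := by
  have h := Complex.one_sub_conj_mul_ne_zero hw hu.le
  rw [discAut, norm_div, div_eq_one_iff_eq (norm_ne_zero_iff.2 h),
    Complex.one_sub_conj_mul_eq hu, norm_mul, hu, one_mul, RCLike.norm_conj]

@[simp]
theorem discAut_zero (u : ℂ) : discAut 0 u = u := by simp [discAut]

theorem discAut_mul_mul {ζ : ℂ} (hζ : ‖ζ‖ = 1) (w u : ℂ) :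
    discAut (ζ * w) (ζ * u) = ζ * discAut w u := by
  have h := Complex.mul_conj_of_norm_eq_one hζ
  have : 1 - conj (ζ * w) * (ζ * u) = 1 - conj w * u := by
    rw [map_mul]
    linear_combination (-conj w * u) * h
  rw [discAut, discAut, this, ← mul_sub, mul_div_assoc]

/-- The group law: the maps `discAut w` are closed under composition only up to a rotation, which is
why `DiscEquiv` carries a factor `ζ`. -/
theorem discAut_discAut {w w' u : ℂ} (hw : ‖w‖ < 1) (hw' : ‖w'‖ < 1) (hu : ‖u‖ = 1) :
    discAut w' (discAut w u) = (1 + w' * conj w) / (1 + conj w' * w) *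
      discAut ((w + w') / (1 + w' * conj w)) u := by
  have h1 := Complex.one_sub_conj_mul_ne_zero hw hu.le
  have h2 := Complex.one_sub_conj_mul_ne_zero hw' (norm_discAut hw hu).le
  have h3 : 1 + conj w' * w ≠ 0 := by
    simpa using Complex.one_sub_conj_mul_ne_zero (u := -w) hw' (by simpa using hw.le)
  have h4 : 1 + w' * conj w ≠ 0 := by
    have := (map_ne_zero (starRingEnd ℂ)).2 h3
    simpa using this
  have h5 : 1 - conj ((w + w') / (1 + w' * conj w)) * u =
      (1 - conj w * u) * (1 - conj w' * discAut w u) / (1 + conj w' * w) := by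
    simp only [map_div₀, map_add, map_one, map_mul, Complex.conj_conj, discAut]
    field_simp
    ring
  have h6 : u - (w + w') / (1 + w' * conj w) =
      (1 - conj w * u) * (discAut w u - w') / (1 + w' * conj w) := by
    have hd : (1 - conj w * u) * discAut w u = u - w := mul_div_cancel₀ _ h1
    field_simp
    linear_combination -hd
  change (discAut w u - w') / (1 - conj w' * discAut w u) = _ * (_ / _)
  rw [h5, h6]
  field_simp

theorem discAut_neg_discAut {w u : ℂ} (hw : ‖w‖ < 1) (hu : ‖u‖ = 1) :
    discAut (-w) (discAut w u) = u := by
  have h : 1 - conj w * w ≠ 0 := Complex.one_sub_conj_mul_ne_zero hw hw.le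
  rw [discAut_discAut hw (by simpa using hw) hu]
  have : (1 + -w * conj w) / (1 + conj (-w) * w) = 1 := by
    rw [map_neg, div_eq_one_iff_eq]
    · ring
    · rwa [neg_mul, ← sub_eq_add_neg]
  rw [this]
  simp

theorem norm_add_div_one_add_lt_one {w w' : ℂ} (hw : ‖w‖ < 1) (hw' : ‖w'‖ < 1) :
    ‖(w + w') / (1 + w' * conj w)‖ < 1 := by
  have h3 : 1 + conj w * w' ≠ 0 := by
    simpa using Complex.one_sub_conj_mul_ne_zero (u := -w') hw (by simpa using hw'.le)
  rw [mul_comm w', norm_div, div_lt_one (norm_pos_iff.2 h3)]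
  apply lt_of_pow_lt_pow_left₀ 2 (norm_nonneg _)
  have e1 := hw
  have e2 := hw'
  rw [← sq_lt_one_iff₀ (norm_nonneg _), ← Complex.normSq_eq_norm_sq, Complex.normSq_apply] at e1 e2
  rw [← Complex.normSq_eq_norm_sq, ← Complex.normSq_eq_norm_sq, Complex.normSq_apply,
    Complex.normSq_apply]
  simp only [Complex.add_re, Complex.add_im, Complex.mul_re, Complex.mul_im, Complex.conj_re,
    Complex.conj_im, Complex.one_re, Complex.one_im]
  nlinarith [mul_pos (sub_pos.2 e1) (sub_pos.2 e2)]

theorem norm_one_add_div_one_add {w w' : ℂ} (hw : ‖w‖ < 1) (hw' : ‖w'‖ < 1) :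
    ‖(1 + w' * conj w) / (1 + conj w' * w)‖ = 1 := by
  have h3 : 1 + conj w' * w ≠ 0 := by
    simpa using Complex.one_sub_conj_mul_ne_zero (u := -w) hw' (by simpa using hw.le)
  rw [norm_div, div_eq_one_iff_eq (norm_ne_zero_iff.2 h3), ← RCLike.norm_conj]
  simp

/-- The source of uniqueness: `discAut w` displaces every point of the circle against the direction
of `w`, strictly so unless the point lies on the real line through `w`. -/
theorem re_conj_mul_discAut_sub {w u : ℂ} (hw : ‖w‖ < 1) (hu : ‖u‖ = 1) :
    (conj w * (discAut w u - u)).re =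
      -2 * (conj w * u).im ^ 2 / Complex.normSq (1 - conj w * u) := by
  have h := Complex.one_sub_conj_mul_ne_zero hw hu.le
  have hc := (map_ne_zero (starRingEnd ℂ)).2 h
  have h1 : conj w * (discAut w u - u) =
      ((conj w * u) ^ 2 - conj w * w) * conj (1 - conj w * u) /
        (Complex.normSq (1 - conj w * u) : ℂ) := by
    rw [← Complex.mul_conj, discAut]
    field_simp
    ring
  have hn : u.re * u.re + u.im * u.im = 1 := by
    rw [← Complex.normSq_apply, Complex.normSq_eq_norm_sq, hu, one_pow]
  rw [h1, Complex.div_ofReal_re]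
  congr 1
  simp only [Complex.mul_re, Complex.sub_re, Complex.sub_im, Complex.mul_im, Complex.conj_re,
    Complex.conj_im, Complex.one_re, Complex.one_im, pow_two]
  generalize u.re = x at *
  generalize u.im = y at *
  generalize w.re = p at *
  generalize w.im = q at *
  linear_combination ((p * p + q * q) * (1 - (p * x + q * y))) * hn

end DiscAut

/-- Two configurations of points on the unit circle that differ by an automorphism of the disc. -/
def DiscEquiv {ι : Type*} (u v : ι → ℂ) : Prop :=
  ∃ ζ w : ℂ, ‖ζ‖ = 1 ∧ ‖w‖ < 1 ∧ ∀ i, v i = ζ * discAut w (u i)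

namespace DiscEquiv

open ComplexConjugate

variable {ι : Type*} {u v x : ι → ℂ}

theorem of_rotation {ζ : ℂ} (hζ : ‖ζ‖ = 1) (h : ∀ i, v i = ζ * u i) : DiscEquiv u v :=
  ⟨ζ, 0, hζ, by simp, by simpa using h⟩

theorem of_discAut {w : ℂ} (hw : ‖w‖ < 1) : DiscEquiv u (fun i => discAut w (u i)) :=
  ⟨1, w, by simp, hw, by simp⟩

theorem symm (hu : ∀ i, ‖u i‖ = 1) (h : DiscEquiv u v) : DiscEquiv v u := by
  obtain ⟨ζ, w, hζ, hw, h⟩ := h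
  have hc : ‖conj ζ‖ = 1 := by rwa [RCLike.norm_conj]
  have hz := Complex.mul_conj_of_norm_eq_one hζ
  refine ⟨conj ζ, -(ζ * w), hc, by simpa [hζ] using hw, fun i => ?_⟩
  rw [← discAut_mul_mul hc, h i]
  have e1 : conj ζ * -(ζ * w) = -w := by linear_combination (-w) * hz
  have e2 : conj ζ * (ζ * discAut w (u i)) = discAut w (u i) := by
    linear_combination (discAut w (u i)) * hz
  rw [e1, e2, discAut_neg_discAut hw (hu i)]

theorem trans (hu : ∀ i, ‖u i‖ = 1) (h : DiscEquiv u v) (h' : DiscEquiv v x) : DiscEquiv u x := by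
  obtain ⟨ζ, w, hζ, hw, h⟩ := h
  obtain ⟨ζ', w', hζ', hw', h'⟩ := h'
  have hz := Complex.mul_conj_of_norm_eq_one hζ
  have hc : ‖conj ζ * w'‖ < 1 := by simpa [hζ] using hw'
  refine ⟨ζ' * (ζ * ((1 + conj ζ * w' * conj w) / (1 + conj (conj ζ * w') * w))),
    (w + conj ζ * w') / (1 + conj ζ * w' * conj w), ?_, norm_add_div_one_add_lt_one hw hc, ?_⟩
  · rw [norm_mul, norm_mul, norm_one_add_div_one_add hw hc, hζ, hζ']
    simp
  · intro i
    have e1 : w' = ζ * (conj ζ * w') := by linear_combination (-w') * hz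
    rw [h' i, h i, mul_assoc, mul_assoc, ← discAut_discAut hw hc (hu i)]
    conv_lhs => rw [e1, discAut_mul_mul hζ]

theorem norm_eq (hu : ∀ i, ‖u i‖ = 1) (h : DiscEquiv u v) (i : ι) : ‖v i‖ = 1 := by
  obtain ⟨ζ, w, hζ, hw, h⟩ := h
  rw [h i, norm_mul, hζ, norm_discAut hw (hu i), one_mul]

end DiscEquiv

/-! ### Stability and uniqueness of the conformal barycenter -/

open Classical in
/-- A configuration of weighted points is stable if the weight of every point of the circle is less
than half of the total weight. -/
def IsStableConfig {ι : Type*} [Fintype ι] (l : ι → ℝ) (u : ι → ℂ) : Prop :=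
  ∀ ζ : ℂ, ‖ζ‖ = 1 → ∑ i, (if u i = ζ then (1 : ℝ) else -1) * l i < 0

section Uniqueness

open ComplexConjugate

variable {ι : Type*} [Fintype ι] {l : ι → ℝ} {u v : ι → ℂ}

/-- The points of a closed stable configuration are not on a line through the origin. -/
theorem eq_zero_of_forall_im_conj_mul_eq_zero (hu : ∀ i, ‖u i‖ = 1)
    (hs : IsStableConfig l u) (h0 : ∑ i, (l i : ℂ) * u i = 0) {w : ℂ}
    (h3 : ∀ i, (conj w * u i).im = 0) : w = 0 := by
  classical
  by_contra hw0
  have hn : (‖w‖ : ℂ) ≠ 0 := by simpa using hw0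
  have hww : conj w * w = (‖w‖ : ℂ) ^ 2 := Complex.conj_mul' w
  set ζ : ℂ := w / ‖w‖ with hζ
  have hζ1 : ‖ζ‖ = 1 := by rw [hζ, norm_div]; simp [hw0]
  have h4 : ∀ i, u i = ζ ∨ u i = -ζ := by
    intro i
    have e : ((conj w * u i).re : ℂ) = conj w * u i := by
      apply Complex.ext <;> simp [h3 i]
    set r := (conj w * u i).re
    have hr : |r| = ‖w‖ := by
      have := congrArg norm e
      rwa [norm_mul, hu i, RCLike.norm_conj, mul_one, Complex.norm_real, Real.norm_eq_abs] at this
    have hw2 : conj w ≠ 0 := (map_ne_zero _).2 hw0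
    rcases abs_cases r with ⟨h, -⟩ | ⟨h, -⟩
    · left
      apply mul_left_cancel₀ hw2
      rw [← e, ← h, hr, hζ, mul_div_assoc', hww]
      field_simp
    · right
      apply mul_left_cancel₀ hw2
      have : r = -‖w‖ := by rw [← hr, h, neg_neg]
      rw [← e, this, hζ, mul_neg, mul_div_assoc', hww]
      push_cast
      field_simp
  -- All points are `ζ` or `-ζ`, so the center of mass is a multiple of `ζ` whose coefficient
  -- stability makes negative.
  have h5 : ∑ i, (l i : ℂ) * u i =
      ((∑ i, (if u i = ζ then (1 : ℝ) else -1) * l i : ℝ) : ℂ) * ζ := by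
    rw [Complex.ofReal_sum, Finset.sum_mul]
    refine Finset.sum_congr rfl fun i _ => ?_
    by_cases h : u i = ζ
    · simp [h]
    · rw [if_neg h, (h4 i).resolve_left h]
      push_cast
      ring
  rw [h0] at h5
  have h6 := (mul_eq_zero.1 h5.symm).resolve_right (fun h => by simp [h] at hζ1)
  have h7 := hs ζ hζ1
  rw [Complex.ofReal_eq_zero] at h6
  exact h7.ne h6

/-- Pairing the displacement of the center of mass with `w` gives a sum of terms of one sign. It
vanishes, so every point lies on the line through `w`, against stability unless `w = 0`. -/
theorem eq_zero_of_sum_discAut_eq_zero (hl : ∀ i, 0 < l i) (hu : ∀ i, ‖u i‖ = 1)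
    (hs : IsStableConfig l u) (h0 : ∑ i, (l i : ℂ) * u i = 0) {w : ℂ} (hw : ‖w‖ < 1)
    (h1 : ∑ i, (l i : ℂ) * discAut w (u i) = 0) : w = 0 := by
  have h2 : ∑ i, l i * (2 * (conj w * u i).im ^ 2 / Complex.normSq (1 - conj w * u i)) = 0 := by
    have : (conj w * (∑ i, (l i : ℂ) * discAut w (u i) - ∑ i, (l i : ℂ) * u i)).re = 0 := by
      rw [h0, h1]; simp
    rw [← Finset.sum_sub_distrib, Finset.mul_sum, Complex.re_sum] at this
    rw [← neg_eq_zero, ← this, ← Finset.sum_neg_distrib]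
    refine Finset.sum_congr rfl fun i _ => ?_
    rw [← mul_sub, mul_left_comm, Complex.re_ofReal_mul, re_conj_mul_discAut_sub hw (hu i)]
    ring
  have h3 : ∀ i, (conj w * u i).im = 0 := by
    rw [Finset.sum_eq_zero_iff_of_nonneg (fun i _ => mul_nonneg (hl i).le
      (div_nonneg (by positivity) (Complex.normSq_nonneg _)))] at h2
    intro i
    have h4 := h2 i (Finset.mem_univ i)
    have h5 := Complex.normSq_pos.2 (Complex.one_sub_conj_mul_ne_zero hw (hu i).le)
    rcases mul_eq_zero.1 h4 with h | h
    · exact absurd h (hl i).ne'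
    · rcases div_eq_zero_iff.1 h with h | h
      · simpa using h
      · exact absurd h h5.ne'
  exact eq_zero_of_forall_im_conj_mul_eq_zero hu hs h0 h3

/-- Closed stable configurations that differ by an automorphism of the disc differ by a rotation. -/
theorem DiscEquiv.exists_rotation (hl : ∀ i, 0 < l i) (hu : ∀ i, ‖u i‖ = 1)
    (hs : IsStableConfig l u) (h0 : ∑ i, (l i : ℂ) * u i = 0) (h : DiscEquiv u v)
    (h1 : ∑ i, (l i : ℂ) * v i = 0) : ∃ ζ : ℂ, ‖ζ‖ = 1 ∧ ∀ i, v i = ζ * u i := by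
  obtain ⟨ζ, w, hζ, hw, h⟩ := h
  have hw0 : w = 0 := by
    refine eq_zero_of_sum_discAut_eq_zero hl hu hs h0 hw ?_
    have h2 : ζ * ∑ i, (l i : ℂ) * discAut w (u i) = 0 := by
      rw [← h1, Finset.mul_sum]
      exact Finset.sum_congr rfl fun i _ => by rw [h i]; ring
    exact (mul_eq_zero.1 h2).resolve_left (fun h => by simp [h] at hζ)
  exact ⟨ζ, hζ, by simpa [hw0] using h⟩

open Classical in
-- Automorphisms permute the points of the circle, so the weights accumulated at single points do
-- not change.
theorem IsStableConfig.discAut (hs : IsStableConfig l u) (hu : ∀ i, ‖u i‖ = 1)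
    {w : ℂ} (hw : ‖w‖ < 1) : IsStableConfig l (fun i => discAut w (u i)) := by
  intro ζ hζ
  have hw' : ‖-w‖ < 1 := by simpa using hw
  have key : ∀ i, _root_.discAut w (u i) = ζ ↔ u i = _root_.discAut (-w) ζ := by
    intro i
    constructor
    · intro h
      rw [← h, discAut_neg_discAut hw (hu i)]
    · intro h
      have := discAut_neg_discAut hw' hζ
      rw [neg_neg] at this
      rw [h, this]
  simp only [key]
  exact hs _ (norm_discAut hw' hζ)

/-- The conformal barycenter is unique. -/
theorem eq_of_sum_discAut_eq_zero (hl : ∀ i, 0 < l i) (hu : ∀ i, ‖u i‖ = 1)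
    (hs : IsStableConfig l u) {w w' : ℂ} (hw : ‖w‖ < 1) (hw' : ‖w'‖ < 1)
    (h : ∑ i, (l i : ℂ) * discAut w (u i) = 0) (h' : ∑ i, (l i : ℂ) * discAut w' (u i) = 0) :
    w = w' := by
  have hv : ∀ i, ‖discAut w (u i)‖ = 1 := fun i => norm_discAut hw (hu i)
  have hnw : ‖-w‖ < 1 := by simpa using hw
  -- Undo `w`, then apply `w'`: this reduces to the case where the configuration is already
  -- balanced.
  have key : ∀ i, discAut w' (u i) = (1 + w' * conj (-w)) / (1 + conj w' * (-w)) *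
      discAut ((-w + w') / (1 + w' * conj (-w))) (discAut w (u i)) := by
    intro i
    rw [← discAut_discAut hnw hw' (hv i), discAut_neg_discAut hw (hu i)]
  have h1 := eq_zero_of_sum_discAut_eq_zero hl hv (hs.discAut hu hw) h
    (norm_add_div_one_add_lt_one hnw hw') (by
      have hne := norm_one_add_div_one_add hnw hw'
      have h2 : ((1 + w' * conj (-w)) / (1 + conj w' * (-w))) * ∑ i, (l i : ℂ) *
          discAut ((-w + w') / (1 + w' * conj (-w))) (discAut w (u i)) = 0 := by
        rw [← h', Finset.mul_sum]
        exact Finset.sum_congr rfl fun i _ => by rw [key i]; ring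
      exact (mul_eq_zero.1 h2).resolve_left (fun h => by rw [h, norm_zero] at hne; exact zero_ne_one hne))
  rcases div_eq_zero_iff.1 h1 with h2 | h2
  · linear_combination -h2
  · have := norm_one_add_div_one_add hnw hw'
    rw [h2] at this
    simp at this

end Uniqueness

/-! ### Existence of the conformal barycenter by minimizing a potential -/

section Existence

open ComplexConjugate Filter

variable {ι : Type*} [Fintype ι] {l : ι → ℝ} {u : ι → ℂ}

/-- The potential on the unit disc whose critical point is the conformal barycenter. -/
noncomputable def discPotential (l : ι → ℝ) (u : ι → ℂ) (w : ℂ) : ℝ :=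
  ∑ i, l i * (Real.log (Complex.normSq (u i - w)) - Real.log (1 - Complex.normSq w))

theorem Complex.one_sub_normSq_pos {w : ℂ} (hw : ‖w‖ < 1) : 0 < 1 - Complex.normSq w := by
  rw [Complex.normSq_eq_norm_sq]
  nlinarith [norm_nonneg w]

theorem Complex.sub_ne_zero_of_norm {w u : ℂ} (hw : ‖w‖ < 1) (hu : ‖u‖ = 1) : u - w ≠ 0 := by
  intro h
  rw [sub_eq_zero.1 h] at hu
  exact hw.ne hu

theorem continuousAt_discPotential (hu : ∀ i, ‖u i‖ = 1) {w : ℂ} (hw : ‖w‖ < 1) :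
    ContinuousAt (discPotential l u) w := by
  unfold discPotential
  refine tendsto_finsetSum _ fun i _ => ?_
  refine ContinuousAt.mul continuousAt_const (ContinuousAt.sub ?_ ?_)
  · exact ContinuousAt.log (by fun_prop)
      (Complex.normSq_pos.2 (Complex.sub_ne_zero_of_norm hw (hu i))).ne'
  · exact ContinuousAt.log (by fun_prop) (Complex.one_sub_normSq_pos hw).ne'

/-- Near `ζ` each point equal to `ζ` contributes at least its weight times `log (1 - |w|²)`, up to a
constant, and each other point minus its weight times this logarithm, up to a convergent term.
Stability makes the total coefficient negative, while the logarithm tends to `-∞`. -/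
theorem tendsto_discPotential_atTop (hl : ∀ i, 0 < l i) (hs : IsStableConfig l u) {ζ : ℂ}
    (hζ : ‖ζ‖ = 1) : Tendsto (discPotential l u) (𝓝[Metric.ball 0 1] ζ) atTop := by
  classical
  have h1 : Tendsto (fun w : ℂ => 1 - Complex.normSq w) (𝓝[Metric.ball 0 1] ζ) (𝓝[>] 0) := by
    rw [tendsto_nhdsWithin_iff]
    constructor
    · have : Tendsto (fun w : ℂ => 1 - Complex.normSq w) (𝓝 ζ) (𝓝 (1 - Complex.normSq ζ)) :=
        Continuous.tendsto (by fun_prop) ζ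
      rw [Complex.normSq_eq_norm_sq, hζ, one_pow, sub_self] at this
      exact this.mono_left nhdsWithin_le_nhds
    · filter_upwards [self_mem_nhdsWithin] with w hw
      exact Complex.one_sub_normSq_pos (by simpa using hw)
  have h2 := Real.tendsto_log_nhdsGT_zero.comp h1
  have h3 := h2.const_mul_atBot_of_neg (hs ζ hζ)
  let g : ι → ℂ → ℝ := fun i w =>
    if u i = ζ then l i * (-2 * Real.log 2) else l i * Real.log (Complex.normSq (u i - w))
  have hg : ∀ i, ContinuousAt (g i) ζ := by
    intro i
    by_cases h : u i = ζ
    · simp only [g, if_pos h]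
      exact continuousAt_const
    · simp only [g, if_neg h]
      exact continuousAt_const.mul (ContinuousAt.log (by fun_prop)
        (Complex.normSq_pos.2 (sub_ne_zero.2 h)).ne')
  have h4 : Tendsto (fun w => ∑ i, g i w) (𝓝[Metric.ball 0 1] ζ) (𝓝 (∑ i, g i ζ)) :=
    (tendsto_finsetSum _ fun i _ => hg i).mono_left nhdsWithin_le_nhds
  refine tendsto_atTop_mono' _ ?_ (h3.atTop_add h4)
  filter_upwards [self_mem_nhdsWithin] with w hw
  have hw : ‖w‖ < 1 := by simpa using hw
  have hp := Complex.one_sub_normSq_pos hw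
  simp only [Function.comp, discPotential]
  rw [Finset.sum_mul, ← Finset.sum_add_distrib]
  refine Finset.sum_le_sum fun i _ => ?_
  by_cases h : u i = ζ
  -- The bound is `|ζ - w| ≥ 1 - |w| ≥ (1 - |w|²) / 2`; the `2` produces the constant `-2 log 2` in
  -- `g`.
  · simp only [g, h, if_true]
    have h5 : Real.log (((1 - Complex.normSq w) / 2) ^ 2) ≤
        Real.log (Complex.normSq (ζ - w)) := by
      refine Real.log_le_log (by positivity) ?_
      have h6 : 1 - ‖w‖ ≤ ‖ζ - w‖ := by
        rw [← hζ]; exact norm_sub_norm_le ζ w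
      rw [Complex.normSq_eq_norm_sq (ζ - w)]
      refine pow_le_pow_left₀ (by positivity) (le_trans ?_ h6) 2
      rw [Complex.normSq_eq_norm_sq]
      nlinarith [norm_nonneg w]
    rw [Real.log_pow, Real.log_div hp.ne' two_ne_zero] at h5
    push_cast at h5
    nlinarith [hl i]
  · simp only [g, if_neg h]
    linarith

theorem exists_isLocalMin_discPotential (hl : ∀ i, 0 < l i) (hu : ∀ i, ‖u i‖ = 1)
    (hs : IsStableConfig l u) : ∃ w : ℂ, ‖w‖ < 1 ∧ IsLocalMin (discPotential l u) w := by
  -- Extended by zero, the exponential of minus the potential is continuous on the compact disc. It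
  -- is positive at `0`, so its maximum is attained in the interior.
  let Q : ℂ → ℝ := fun w => if ‖w‖ < 1 then Real.exp (-discPotential l u w) else 0
  have hball : ∀ w : ℂ, ‖w‖ < 1 → ∀ᶠ x in 𝓝 w, ‖x‖ < 1 := fun w hw =>
    continuous_norm.continuousAt.eventually_lt continuousAt_const hw
  have hQ : ContinuousOn Q (Metric.closedBall 0 1) := by
    intro w hw
    rcases (by simpa using hw : ‖w‖ ≤ 1).lt_or_eq with h | h
    · have : ContinuousAt (fun w => Real.exp (-discPotential l u w)) w :=
        (continuousAt_discPotential hu h).neg.rexp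
      refine (this.congr ?_).continuousWithinAt
      filter_upwards [hball w h] with x hx
      simp [Q, hx]
    · rw [← Metric.ball_union_sphere]
      have hQw : Q w = 0 := by simp [Q, h]
      refine ContinuousWithinAt.union ?_ ?_
      · have h1 := Real.tendsto_exp_neg_atTop_nhds_zero.comp (tendsto_discPotential_atTop hl hs h)
        rw [ContinuousWithinAt, hQw]
        refine h1.congr' ?_
        filter_upwards [self_mem_nhdsWithin] with x hx
        have hx : ‖x‖ < 1 := by simpa using hx
        simp [Q, hx]
      · rw [ContinuousWithinAt, hQw]
        refine tendsto_const_nhds.congr' ?_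
        filter_upwards [self_mem_nhdsWithin] with x hx
        have hx : ‖x‖ = 1 := by simpa using hx
        simp [Q, hx]
  obtain ⟨w, hwb, hw⟩ := (isCompact_closedBall (0 : ℂ) 1).exists_isMaxOn ⟨0, by simp⟩ hQ
  have hpos : 0 < Q w := by
    refine lt_of_lt_of_le ?_ (hw (show (0 : ℂ) ∈ Metric.closedBall 0 1 by simp))
    simp only [Q, norm_zero, zero_lt_one, if_true]
    exact Real.exp_pos _
  have hw1 : ‖w‖ < 1 := by
    by_contra h
    simp [Q, h] at hpos
  refine ⟨w, hw1, ?_⟩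
  filter_upwards [hball w hw1] with x hx
  have := hw (show x ∈ Metric.closedBall 0 1 by simpa using hx.le)
  simp only [Q, hx, hw1, if_true, mem_ofPred_eq, Real.exp_le_exp] at this
  linarith

theorem Complex.hasDerivAt_normSq_line (p d : ℂ) :
    HasDerivAt (fun s : ℝ => Complex.normSq (p + s * d)) (2 * (p * conj d).re) 0 := by
  have h : (fun s : ℝ => Complex.normSq (p + s * d)) = fun s : ℝ =>
      Complex.normSq p + s * (2 * (p * conj d).re) + s ^ 2 * Complex.normSq d := by
    funext s
    simp only [Complex.normSq_apply, Complex.add_re, Complex.add_im, Complex.mul_re,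
      Complex.mul_im, Complex.ofReal_re, Complex.ofReal_im, Complex.conj_re, Complex.conj_im]
    ring
  rw [h]
  have h1 := ((hasDerivAt_id (0 : ℝ)).mul_const (2 * (p * conj d).re)).const_add (Complex.normSq p)
  have h2 := ((hasDerivAt_id (0 : ℝ)).pow 2).mul_const (Complex.normSq d)
  simpa using h1.fun_add h2

/-- A stable configuration of points on the circle is mapped by an automorphism of the disc to a
configuration whose center of mass is the origin. -/
theorem exists_sum_discAut_eq_zero (hl : ∀ i, 0 < l i) (hu : ∀ i, ‖u i‖ = 1)
    (hs : IsStableConfig l u) : ∃ w : ℂ, ‖w‖ < 1 ∧ ∑ i, (l i : ℂ) * discAut w (u i) = 0 := by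
  obtain ⟨w, hw, hmin⟩ := exists_isLocalMin_discPotential hl hu hs
  refine ⟨w, hw, ?_⟩
  have hp := Complex.one_sub_normSq_pos hw
  have hpc : (1 : ℂ) - w * conj w ≠ 0 := by
    rw [Complex.mul_conj]
    exact_mod_cast hp.ne'
  set Z : ℂ := ∑ i, (l i : ℂ) * discAut w (u i) with hZ
  -- Up to a nonzero factor, `Z` is the gradient of the potential at `w`; it is tested on every
  -- direction `d`, and finally on `d = Z`.
  have key : ∀ d : ℂ, (Z * conj d).re = 0 := by
    intro d
    have hd : HasDerivAt (fun s : ℝ => discPotential l u (w + s * d))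
        (∑ i, l i * (2 * ((u i - w) * conj (-d)).re / Complex.normSq (u i - w) -
          (-(2 * (w * conj d).re)) / (1 - Complex.normSq w))) 0 := by
      unfold discPotential
      refine HasDerivAt.fun_sum fun i _ => HasDerivAt.const_mul _ (HasDerivAt.sub ?_ ?_)
      · have h1 := Complex.hasDerivAt_normSq_line (u i - w) (-d)
        have h2 : (fun s : ℝ => Complex.normSq (u i - w + s * -d)) =
            fun s : ℝ => Complex.normSq (u i - (w + s * d)) := by
          funext s; congr 1; ring
        rw [h2] at h1
        have h3 := h1.log (by
          simpa using Complex.sub_ne_zero_of_norm hw (hu i))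
        simpa using h3
      · have h1 := (Complex.hasDerivAt_normSq_line w d).const_sub 1
        have h3 := h1.log (by simpa using hp.ne')
        simpa using h3
    have hmin' : IsLocalMin (fun s : ℝ => discPotential l u (w + s * d)) 0 := by
      have hm : ∀ᶠ y in 𝓝 w, discPotential l u w ≤ discPotential l u y := hmin
      have hc : ContinuousAt (fun s : ℝ => w + s * d) 0 := by fun_prop
      have := hc.tendsto.eventually (p := fun x => discPotential l u w ≤ discPotential l u x)
        (by simpa using hm)
      simpa [IsLocalMin, IsMinFilter] using this
    have h0 := hmin'.hasDerivAt_eq_zero hd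
    have h1 : ∀ i, l i * (2 * ((u i - w) * conj (-d)).re / Complex.normSq (u i - w) -
        (-(2 * (w * conj d).re)) / (1 - Complex.normSq w)) =
        -2 / (1 - Complex.normSq w) * ((l i : ℂ) * discAut w (u i) * conj d).re := by
      intro i
      have hne := Complex.sub_ne_zero_of_norm hw (hu i)
      have hne' := (map_ne_zero (starRingEnd ℂ)).2 hne
      have huu := Complex.mul_conj_of_norm_eq_one (hu i)
      have hu0 : u i ≠ 0 := left_ne_zero_of_mul_eq_one huu
      have e1 : (u i - w) * conj (-d) / (Complex.normSq (u i - w) : ℂ) +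
          w * conj d / ((1 - Complex.normSq w : ℝ) : ℂ) =
          (((1 - Complex.normSq w)⁻¹ : ℝ) : ℂ) * (-discAut w (u i) * conj d) := by
        rw [discAut, Complex.one_sub_conj_mul_eq (hu i), ← Complex.mul_conj]
        push_cast
        rw [← Complex.mul_conj]
        rw [map_neg]
        field_simp
        rw [map_sub]
        linear_combination (conj d * w) * huu
      have e2 := congrArg Complex.re e1
      rw [Complex.add_re, Complex.div_ofReal_re, Complex.div_ofReal_re, Complex.re_ofReal_mul,
        neg_mul, Complex.neg_re] at e2
      rw [mul_assoc, Complex.re_ofReal_mul]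
      have e3 : 2 * ((u i - w) * conj (-d)).re / Complex.normSq (u i - w) -
        (-(2 * (w * conj d).re)) / (1 - Complex.normSq w) =
        2 * (((u i - w) * conj (-d)).re / Complex.normSq (u i - w) +
        (w * conj d).re / (1 - Complex.normSq w)) := by ring
      rw [e3, e2]
      ring
    rw [Finset.sum_congr rfl fun i _ => h1 i, ← Finset.mul_sum, ← Complex.re_sum,
      ← Finset.sum_mul, ← hZ] at h0
    exact (mul_eq_zero.1 h0).resolve_left (div_ne_zero (by norm_num) hp.ne')
  have := key Z
  rw [Complex.mul_conj, Complex.ofReal_re] at this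
  exact Complex.normSq_eq_zero.1 this

end Existence

/-! ### Smooth dependence of the conformal barycenter -/

section Smoothness

open ComplexConjugate Filter

variable {ι : Type*} [Fintype ι]

open Classical in
/-- The conformal barycenter of weighted points on the unit circle: the point of the disc that has
to be moved to the origin in order to move the center of mass to the origin. -/
noncomputable def conformalBarycenter (l : ι → ℝ) (u : ι → ℂ) : ℂ :=
  if h : ∃ w : ℂ, ‖w‖ < 1 ∧ ∑ i, (l i : ℂ) * discAut w (u i) = 0 then h.choose else 0

/-- The balanced configuration equivalent to a stable one. -/
noncomputable def balance (l : ι → ℝ) (u : ι → ℂ) (i : ι) : ℂ :=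
  discAut (conformalBarycenter l u) (u i)

/-- Positive weights and stable points on the unit circle. -/
def stableData (ι : Type*) [Fintype ι] : Set ((ι → ℝ) × (ι → ℂ)) :=
  {p | (∀ i, 0 < p.1 i) ∧ (∀ i, ‖p.2 i‖ = 1) ∧ IsStableConfig p.1 p.2}

theorem conformalBarycenter_spec {p : (ι → ℝ) × (ι → ℂ)} (hp : p ∈ stableData ι) :
    ‖conformalBarycenter p.1 p.2‖ < 1 ∧ ∑ i, (p.1 i : ℂ) * balance p.1 p.2 i = 0 := by
  have h := exists_sum_discAut_eq_zero hp.1 hp.2.1 hp.2.2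
  simp only [balance, conformalBarycenter, dif_pos h]
  exact h.choose_spec

theorem conformalBarycenter_eq {p : (ι → ℝ) × (ι → ℂ)} (hp : p ∈ stableData ι) {w : ℂ}
    (hw : ‖w‖ < 1) (h : ∑ i, (p.1 i : ℂ) * discAut w (p.2 i) = 0) :
    conformalBarycenter p.1 p.2 = w :=
  eq_of_sum_discAut_eq_zero hp.1 hp.2.1 hp.2.2 (conformalBarycenter_spec hp).1 hw
    (conformalBarycenter_spec hp).2 h

theorem Complex.contDiff_conj : ContDiff ℝ ∞ (fun z : ℂ => conj z) :=
  Complex.conjCLE.contDiff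

theorem ContDiffWithinAt.complex_div {V : Type*} [NormedAddCommGroup V] [NormedSpace ℝ V]
    {f g : V → ℂ} {s : Set V} {x : V} (hf : ContDiffWithinAt ℝ ∞ f s x)
    (hg : ContDiffWithinAt ℝ ∞ g s x) (h : g x ≠ 0) :
    ContDiffWithinAt ℝ ∞ (fun y => f y / g y) s x := by
  simp only [div_eq_mul_inv]
  exact hf.mul (hg.inv h)

theorem ContDiffWithinAt.discAut {V : Type*} [NormedAddCommGroup V] [NormedSpace ℝ V]
    {f g : V → ℂ} {s : Set V} {x : V} (hf : ContDiffWithinAt ℝ ∞ f s x)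
    (hg : ContDiffWithinAt ℝ ∞ g s x) (h : 1 - conj (f x) * g x ≠ 0) :
    ContDiffWithinAt ℝ ∞ (fun y => discAut (f y) (g y)) s x := by
  have hc : ContDiffWithinAt ℝ ∞ (fun y => conj (f y)) s x :=
    Complex.contDiff_conj.contDiffAt.comp_contDiffWithinAt x hf
  exact (hg.sub hf).complex_div (contDiffWithinAt_const.sub (hc.mul hg)) h

theorem hasFDerivAt_discAut_zero (y : ℂ) :
    HasFDerivAt (fun v => discAut v y)
      (-ContinuousLinearMap.id ℝ ℂ + (y ^ 2) • (Complex.conjCLE : ℂ →L[ℝ] ℂ)) 0 := by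
  have h1 : HasFDerivAt (fun v : ℂ => y - v) (-ContinuousLinearMap.id ℝ ℂ) 0 :=
    (hasFDerivAt_id (𝕜 := ℝ) (0 : ℂ)).const_sub y
  have h2 : HasFDerivAt (fun v : ℂ => conj v) (Complex.conjCLE : ℂ →L[ℝ] ℂ) 0 :=
    Complex.conjCLE.hasFDerivAt
  have h3 := (h2.mul_const y).const_sub 1
  have h4 := h1.mul
    (((hasFDerivAt_inv (𝕜 := ℂ) (x := 1 - conj 0 * y) (by simp)).restrictScalars ℝ).comp 0 h3)
  refine (h4.congr_fderiv ?_).congr_of_eventuallyEq (Eventually.of_forall fun v => ?_)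
  · ext <;> (simp; ring)
  · simp [discAut, div_eq_mul_inv]

/-- The implicit function theorem is applied after moving the barycenter of the base point to the
origin, where the derivative is simple. This derivative is injective by the infinitesimal form of
the uniqueness argument. -/
theorem contDiffOn_conformalBarycenter :
    ContDiffOn ℝ ∞ (fun p : (ι → ℝ) × (ι → ℂ) => conformalBarycenter p.1 p.2) (stableData ι) := by
  intro p₀ hp₀
  obtain ⟨hl, hu, hs⟩ := id hp₀
  obtain ⟨hw, h0⟩ := conformalBarycenter_spec hp₀
  set w := conformalBarycenter p₀.1 p₀.2 with hwdef
  let f : ((ι → ℝ) × (ι → ℂ)) × ℂ → ℂ := fun q =>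
    ∑ i, (q.1.1 i : ℂ) * discAut q.2 (discAut w (q.1.2 i))
  have hy : ∀ i, ‖discAut w (p₀.2 i)‖ = 1 := fun i => norm_discAut hw (hu i)
  have hf : ContDiffAt ℝ ∞ f (p₀, 0) := by
    refine ContDiffAt.sum fun i _ => ?_
    rw [← contDiffWithinAt_univ]
    have e1 : ContDiffAt ℝ ∞ (fun q : ((ι → ℝ) × (ι → ℂ)) × ℂ => ((q.1.1 i : ℝ) : ℂ)) (p₀, 0) :=
      Complex.ofRealCLM.contDiff.contDiffAt.comp _ (by fun_prop)
    refine e1.contDiffWithinAt.mul (ContDiffWithinAt.discAut ?_ ?_ ?_)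
    · fun_prop
    · refine ContDiffWithinAt.discAut (by fun_prop) ?_ ?_
      · exact ((contDiff_apply ℝ ℂ i).comp (contDiff_snd.comp contDiff_fst)).contDiffWithinAt
      · exact Complex.one_sub_conj_mul_ne_zero hw (hu i).le
    · simp
  have hf0 : f (p₀, 0) = 0 := by
    simpa [f, balance] using h0
  have hder : HasFDerivAt (fun v => f (p₀, v)) (∑ i, (p₀.1 i : ℂ) •
      (-ContinuousLinearMap.id ℝ ℂ + (discAut w (p₀.2 i) ^ 2) • (Complex.conjCLE : ℂ →L[ℝ] ℂ)))
      0 := by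
    change HasFDerivAt (fun v => ∑ i, (p₀.1 i : ℂ) * discAut v (discAut w (p₀.2 i))) _ 0
    exact HasFDerivAt.fun_sum fun i _ => (hasFDerivAt_discAut_zero _).const_mul _
  set L : ℂ →L[ℝ] ℂ := ∑ i, (p₀.1 i : ℂ) •
      (-ContinuousLinearMap.id ℝ ℂ + (discAut w (p₀.2 i) ^ 2) • (Complex.conjCLE : ℂ →L[ℝ] ℂ))
    with hL
  have hcomp : fderiv ℝ f (p₀, 0) ∘L .inr ℝ _ ℂ = L := by
    have h1 : HasFDerivAt (fun v : ℂ => (p₀, v)) (.inr ℝ _ ℂ) 0 := hasFDerivAt_prodMk_right p₀ 0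
    have h2 := (hf.differentiableAt (by simp)).hasFDerivAt.comp (0 : ℂ) h1
    exact h2.unique hder
  have hLv : ∀ v, L v = ∑ i, (p₀.1 i : ℂ) * (-v + discAut w (p₀.2 i) ^ 2 * conj v) := by
    intro v
    simp [hL, mul_add]
  have hinj : ∀ v, L v = 0 → v = 0 := by
    intro v hv
    rw [hLv] at hv
    refine eq_zero_of_forall_im_conj_mul_eq_zero hy (hs.discAut hu hw) h0 ?_
    -- The real part of `conj v * L v` is `-2` times this sum, a linearized
    -- `re_conj_mul_discAut_sub`.
    have h1 : ∑ i, p₀.1 i * (conj v * discAut w (p₀.2 i)).im ^ 2 = 0 := by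
      have h2 : (conj v * ∑ i, (p₀.1 i : ℂ) * (-v + discAut w (p₀.2 i) ^ 2 * conj v)).re = 0 := by
        rw [hv]; simp
      rw [Finset.mul_sum, Complex.re_sum] at h2
      have h3 : ∀ i, (conj v * ((p₀.1 i : ℂ) * (-v + discAut w (p₀.2 i) ^ 2 * conj v))).re =
          -2 * (p₀.1 i * (conj v * discAut w (p₀.2 i)).im ^ 2) := by
        intro i
        have hn : (discAut w (p₀.2 i)).re * (discAut w (p₀.2 i)).re +
            (discAut w (p₀.2 i)).im * (discAut w (p₀.2 i)).im = 1 := by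
          rw [← Complex.normSq_apply, Complex.normSq_eq_norm_sq, hy i, one_pow]
        rw [mul_left_comm, Complex.re_ofReal_mul]
        generalize discAut w (p₀.2 i) = y at *
        simp only [Complex.mul_re, Complex.add_re, Complex.add_im, Complex.mul_im, Complex.conj_re,
          Complex.conj_im, Complex.neg_re, Complex.neg_im, pow_two]
        linear_combination (p₀.1 i * (v.re * v.re + v.im * v.im)) * hn
      rw [Finset.sum_congr rfl fun i _ => h3 i, ← Finset.mul_sum] at h2
      linarith
    rw [Finset.sum_eq_zero_iff_of_nonneg (fun i _ => mul_nonneg (hl i).le (sq_nonneg _))] at h1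
    intro i
    exact pow_eq_zero_iff two_ne_zero |>.1
      ((mul_eq_zero.1 (h1 i (Finset.mem_univ i))).resolve_left (hl i).ne')
  have hinv : (fderiv ℝ f (p₀, 0) ∘L .inr ℝ _ ℂ).IsInvertible := by
    rw [hcomp]
    have hinj' : Function.Injective (L : ℂ →ₗ[ℝ] ℂ) :=
      (injective_iff_map_eq_zero _).2 hinj
    exact ⟨(LinearEquiv.ofInjectiveEndo (L : ℂ →ₗ[ℝ] ℂ) hinj').toContinuousLinearEquiv, by
      ext <;> simp⟩
  have hn : (∞ : WithTop ℕ∞) ≠ 0 := by simp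
  set ψ := hf.implicitFunction hn hinv with hψ
  have hψs : ContDiffAt ℝ ∞ ψ p₀ := hf.contDiffAt_implicitFunction hn hinv
  have hψ0 : ψ p₀ = 0 := hf.implicitFunction_apply_self hn hinv
  have hψf : ∀ᶠ p in 𝓝 p₀, f (p, ψ p) = 0 := by
    simpa [hf0] using hf.eventually_apply_implicitFunction hn hinv
  have hψ1 : ∀ᶠ p in 𝓝 p₀, ‖ψ p‖ < 1 := by
    have := hψs.continuousAt.norm
    exact this.eventually_lt continuousAt_const (by simp [hψ0])
  have hW : ContDiffAt ℝ ∞ (fun p => (w + ψ p) / (1 + ψ p * conj w)) p₀ := by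
    rw [← contDiffWithinAt_univ] at hψs ⊢
    refine (contDiffWithinAt_const.add hψs).complex_div
      (contDiffWithinAt_const.add (hψs.mul contDiffWithinAt_const)) ?_
    simp [hψ0]
  -- `ψ` solves the equation relative to `w`; the group law converts it to a point of the disc.
  -- Uniqueness identifies that point with the barycenter at nearby points of `stableData`.
  refine hW.contDiffWithinAt.congr_of_eventuallyEq ?_ (by simp [hψ0, hwdef])
  filter_upwards [self_mem_nhdsWithin, mem_nhdsWithin_of_mem_nhds hψf,
    mem_nhdsWithin_of_mem_nhds hψ1] with p hp h1 h2
  refine conformalBarycenter_eq hp (norm_add_div_one_add_lt_one hw h2) ?_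
  have h3 : (1 + ψ p * conj w) / (1 + conj (ψ p) * w) * ∑ i, (p.1 i : ℂ) *
      discAut ((w + ψ p) / (1 + ψ p * conj w)) (p.2 i) = 0 := by
    rw [← h1, Finset.mul_sum]
    refine Finset.sum_congr rfl fun i _ => ?_
    rw [discAut_discAut hw h2 (hp.2.1 i)]
    ring
  have hne := norm_one_add_div_one_add hw h2
  exact (mul_eq_zero.1 h3).resolve_left (fun h => by rw [h, norm_zero] at hne; exact zero_ne_one hne)

theorem contDiffOn_balance :
    ContDiffOn ℝ ∞ (fun p : (ι → ℝ) × (ι → ℂ) => balance p.1 p.2) (stableData ι) := by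
  rw [contDiffOn_pi]
  intro i p hp
  refine ContDiffWithinAt.discAut (contDiffOn_conformalBarycenter p hp)
    ((contDiff_apply ℝ ℂ i).comp contDiff_snd).contDiffWithinAt ?_
  exact Complex.one_sub_conj_mul_ne_zero (conformalBarycenter_spec hp).1 (hp.2.1 i).le

end Smoothness

/-! ### Embedded manifolds from local parametrizations -/

section Embedded

variable {V E : Type*} [NormedAddCommGroup V] [NormedSpace ℝ V] [NormedAddCommGroup E]
  [NormedSpace ℝ E]

/-- A subset of a normed space with smooth local parametrizations is a manifold. -/
theorem exists_chartedSpace_of_local_parametrizations (N : Set V)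
    (hN : ∀ p ∈ N, ∃ (S : Set V) (T : Set E) (c : V → E) (g : E → V), IsOpen S ∧ IsOpen T ∧ p ∈ S ∧
      ContDiffOn ℝ ∞ c (N ∩ S) ∧ ContDiffOn ℝ ∞ g T ∧ MapsTo c (N ∩ S) T ∧ MapsTo g T (N ∩ S) ∧
      LeftInvOn g c (N ∩ S) ∧ LeftInvOn c g T) :
    ∃ _ : ChartedSpace E N, IsManifold 𝓘(ℝ, E) ∞ N ∧
      ContMDiff 𝓘(ℝ, E) 𝓘(ℝ, V) ∞ (Subtype.val : N → V) ∧
      ∀ ρ : V → N, (∀ x : N, ρ x.1 = x) → ContMDiffOn 𝓘(ℝ, V) 𝓘(ℝ, E) ∞ ρ N := by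
  classical
  refine exists_chartedSpace_of_local_charts N fun p => ?_
  obtain ⟨S, T, c, g, hS, hT, hpS, hc, hg, hcT, hgS, hgc, hcg⟩ := hN p.1 p.2
  let g' : E → N := fun y => if h : g y ∈ N then ⟨g y, h⟩ else p
  have hg' : ∀ y ∈ T, (g' y).1 = g y := fun y hy => by
    simp [g', (hgS hy).1]
  have himg : Subtype.val '' (Subtype.val ⁻¹' S : Set N) = N ∩ S := by
    rw [Subtype.image_preimage_coe]
  let φ : OpenPartialHomeomorph N E :=
    { toFun := fun x => c x.1
      invFun := g'
      source := Subtype.val ⁻¹' S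
      target := T
      map_source' := fun x hx => hcT ⟨x.2, hx⟩
      map_target' := fun y hy => by
        rw [mem_preimage, hg' y hy]
        exact (hgS hy).2
      left_inv' := fun x hx => Subtype.ext (by
        rw [hg' _ (hcT ⟨x.2, hx⟩)]
        exact hgc ⟨x.2, hx⟩)
      right_inv' := fun y hy => by
        rw [hg' y hy]
        exact hcg hy
      open_source := hS.preimage continuous_subtype_val
      open_target := hT
      continuousOn_toFun := hc.continuousOn.comp continuous_subtype_val.continuousOn
        fun x hx => ⟨x.2, hx⟩
      continuousOn_invFun := by
        rw [Topology.IsInducing.subtypeVal.continuousOn_iff]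
        exact hg.continuousOn.congr hg' }
  refine ⟨φ, hpS, ⟨c, ?_, fun x _ => rfl⟩, ?_⟩
  · change ContDiffOn ℝ ∞ c (Subtype.val '' (Subtype.val ⁻¹' S : Set N))
    rwa [himg]
  · exact hg.congr hg'

end Embedded

/-! ### Smooth solution of a triangle with two given side lengths -/

section Triangle

open ComplexConjugate

/-- The squared half-height, up to scale, of the triangle with sides `A`, `B`, `|s|`. -/
noncomputable def triangleDisc (A B : ℝ) (s : ℂ) : ℝ :=
  4 * A ^ 2 * Complex.normSq s - (Complex.normSq s + A ^ 2 - B ^ 2) ^ 2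

/-- The direction of the first side of the triangle with sides `A`, `B` on the base `s`. -/
noncomputable def triangleDir (σ A B : ℝ) (s : ℂ) : ℂ :=
  s * (((Complex.normSq s + A ^ 2 - B ^ 2 : ℝ) : ℂ) -
    ((σ * √(triangleDisc A B s) : ℝ) : ℂ) * Complex.I) / ((2 * A * Complex.normSq s : ℝ) : ℂ)

variable {σ A B : ℝ} {s : ℂ}

theorem normSq_pos_of_triangleDisc_pos (h : 0 < triangleDisc A B s) : 0 < Complex.normSq s := by
  unfold triangleDisc at h
  by_contra h0
  have : Complex.normSq s = 0 := le_antisymm (not_lt.1 h0) (Complex.normSq_nonneg s)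
  rw [this] at h
  nlinarith [sq_nonneg (0 + A ^ 2 - B ^ 2)]

theorem normSq_triangleDir (hσ : σ = 1 ∨ σ = -1) (hA : 0 < A) (h : 0 < triangleDisc A B s) :
    Complex.normSq (triangleDir σ A B s) = 1 := by
  have hs := normSq_pos_of_triangleDisc_pos h
  have hσ2 : σ ^ 2 = 1 := by rcases hσ with rfl | rfl <;> norm_num
  have hsq := Real.sq_sqrt h.le
  rw [triangleDir, Complex.normSq_div, Complex.normSq_mul, Complex.normSq_ofReal,
    div_eq_one_iff_eq (by positivity)]
  set r := √(triangleDisc A B s)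
  have : Complex.normSq (((Complex.normSq s + A ^ 2 - B ^ 2 : ℝ) : ℂ) - ((σ * r : ℝ) : ℂ) * Complex.I)
      = (Complex.normSq s + A ^ 2 - B ^ 2) ^ 2 + r ^ 2 := by
    rw [Complex.normSq_apply]
    simp only [Complex.sub_re, Complex.sub_im, Complex.ofReal_re, Complex.ofReal_im,
      Complex.re_ofReal_mul, Complex.im_ofReal_mul, Complex.I_re, Complex.I_im]
    linear_combination r ^ 2 * hσ2
  rw [this, hsq, triangleDisc]
  ring

/-- The base seen from the first side: its real part is the law of cosines, and the sign of its
imaginary part selects one of the two mirror triangles. -/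
theorem conj_triangleDir_mul (hs : 0 < Complex.normSq s) :
    conj (triangleDir σ A B s) * s = (((Complex.normSq s + A ^ 2 - B ^ 2 : ℝ) : ℂ) +
      ((σ * √(triangleDisc A B s) : ℝ) : ℂ) * Complex.I) / ((2 * A : ℝ) : ℂ) := by
  have h1 : conj s * s = ((Complex.normSq s : ℝ) : ℂ) := by rw [mul_comm, Complex.mul_conj]
  have h2 : ((Complex.normSq s : ℝ) : ℂ) ≠ 0 := by exact_mod_cast hs.ne'
  rw [triangleDir, map_div₀, map_mul, map_sub, map_mul, Complex.conj_ofReal, Complex.conj_ofReal,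
    Complex.conj_ofReal, Complex.conj_I, div_mul_eq_mul_div, mul_right_comm, h1,
    Complex.ofReal_mul (2 * A), mul_comm ((2 * A : ℝ) : ℂ), mul_div_mul_left _ _ h2]
  ring

theorem normSq_sub_triangleDir (hσ : σ = 1 ∨ σ = -1) (hA : 0 < A) (h : 0 < triangleDisc A B s) :
    Complex.normSq (s - A * triangleDir σ A B s) = B ^ 2 := by
  have hs := normSq_pos_of_triangleDisc_pos h
  have h1 := conj_triangleDir_mul (σ := σ) (A := A) (B := B) hs
  have h2 : (conj (triangleDir σ A B s) * s).re = (Complex.normSq s + A ^ 2 - B ^ 2) / (2 * A) := by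
    rw [h1, Complex.div_ofReal_re, Complex.add_re, Complex.ofReal_re, Complex.re_ofReal_mul,
      Complex.I_re, mul_zero, add_zero]
  rw [Complex.normSq_sub, map_mul (starRingEnd ℂ), Complex.conj_ofReal, Complex.normSq_mul, Complex.normSq_ofReal,
    normSq_triangleDir hσ hA h, mul_left_comm, Complex.re_ofReal_mul, mul_comm s, h2]
  field_simp
  ring

theorem im_conj_triangleDir_mul (hσ : σ = 1 ∨ σ = -1) (hA : 0 < A) (h : 0 < triangleDisc A B s) :
    0 < σ * (conj (triangleDir σ A B s) * (s - A * triangleDir σ A B s)).im := by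
  have hs := normSq_pos_of_triangleDisc_pos h
  have h1 := conj_triangleDir_mul (σ := σ) (A := A) (B := B) hs
  have h2 : (conj (triangleDir σ A B s) * s).im = σ * √(triangleDisc A B s) / (2 * A) := by
    rw [h1, Complex.div_ofReal_im, Complex.add_im, Complex.ofReal_im, Complex.im_ofReal_mul,
      Complex.I_im, mul_one, zero_add]
  have h3 : conj (triangleDir σ A B s) * (s - A * triangleDir σ A B s) =
      conj (triangleDir σ A B s) * s - A * (triangleDir σ A B s * conj (triangleDir σ A B s)) := by
    ring
  have hσ2 : σ * σ = 1 := by rcases hσ with rfl | rfl <;> norm_num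
  rw [h3, Complex.mul_conj, ← Complex.ofReal_mul, Complex.sub_im, Complex.ofReal_im, sub_zero, h2,
    mul_div_assoc', ← mul_assoc, hσ2, one_mul]
  have := Real.sqrt_pos.2 h
  positivity

/-- Heron's formula: both sides are sixteen times the squared area. Hence the square root in
`triangleDir` is smooth as long as the two sides are not parallel. -/
theorem triangleDisc_add {P Q : ℂ} (hP : ‖P‖ = 1) (hQ : ‖Q‖ = 1) :
    triangleDisc A B (A * P + B * Q) = (2 * A * B * (conj P * Q).im) ^ 2 := by
  have hp : P.re * P.re + P.im * P.im = 1 := by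
    rw [← Complex.normSq_apply, Complex.normSq_eq_norm_sq, hP, one_pow]
  have hq : Q.re * Q.re + Q.im * Q.im = 1 := by
    rw [← Complex.normSq_apply, Complex.normSq_eq_norm_sq, hQ, one_pow]
  have hn : Complex.normSq (A * P + B * Q) =
      A ^ 2 + B ^ 2 + 2 * A * B * (P.re * Q.re + P.im * Q.im) := by
    rw [Complex.normSq_apply]
    simp only [Complex.add_re, Complex.add_im, Complex.re_ofReal_mul, Complex.im_ofReal_mul]
    linear_combination A ^ 2 * hp + B ^ 2 * hq
  have h2 : (P.re * Q.im - P.im * Q.re) ^ 2 = 1 - (P.re * Q.re + P.im * Q.im) ^ 2 := by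
    linear_combination (Q.re * Q.re + Q.im * Q.im) * hp + hq
  have h3 : (conj P * Q).im = P.re * Q.im - P.im * Q.re := by
    simp only [Complex.mul_im, Complex.conj_re, Complex.conj_im]
    ring
  rw [triangleDisc, hn, h3, mul_pow, h2]
  ring

/-- The orientation `σ` resolves the ambiguity of the square root, so the triangle is recovered from
its base. -/
theorem triangleDir_add (hσ : σ = 1 ∨ σ = -1) (hA : 0 < A) (hB : 0 < B) {P Q : ℂ} (hP : ‖P‖ = 1)
    (hQ : ‖Q‖ = 1) (h : 0 < σ * (conj P * Q).im) : triangleDir σ A B (A * P + B * Q) = P := by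
  have hd := triangleDisc_add (A := A) (B := B) hP hQ
  have hpos : 0 < triangleDisc A B (A * P + B * Q) := by
    rw [hd]
    have : (conj P * Q).im ≠ 0 := fun h0 => by simp [h0] at h
    positivity
  have hs := normSq_pos_of_triangleDisc_pos hpos
  have hσ2 : σ * σ = 1 := by rcases hσ with rfl | rfl <;> norm_num
  have hr : √(triangleDisc A B (A * P + B * Q)) = 2 * A * B * (σ * (conj P * Q).im) := by
    rw [hd, show (2 * A * B * (conj P * Q).im) ^ 2 = (2 * A * B * (σ * (conj P * Q).im)) ^ 2 by
      linear_combination (-(2 * A * B * (conj P * Q).im) ^ 2) * hσ2]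
    exact Real.sqrt_sq (by positivity)
  have hA' : (A : ℂ) ≠ 0 := by exact_mod_cast hA.ne'
  have h1 := conj_triangleDir_mul (σ := σ) (A := A) (B := B) hs
  have hP1 := Complex.mul_conj_of_norm_eq_one hP
  have hQ1 := Complex.mul_conj_of_norm_eq_one hQ
  have h2 : conj P * (A * P + B * Q) = (((Complex.normSq (A * P + B * Q) + A ^ 2 - B ^ 2 : ℝ) : ℂ) +
      ((σ * √(triangleDisc A B (A * P + B * Q)) : ℝ) : ℂ) * Complex.I) / ((2 * A : ℝ) : ℂ) := by
    have him : ((conj P * Q).im : ℂ) * Complex.I = (conj P * Q - P * conj Q) / 2 := by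
      apply Complex.ext
      · simp
      · simp
        ring
    have hσ2' : (σ : ℂ) * σ = 1 := by exact_mod_cast hσ2
    rw [hr]
    push_cast
    rw [← Complex.mul_conj]
    have e : (σ : ℂ) * (2 * A * B * (σ * ((conj P * Q).im : ℂ))) * Complex.I =
        A * B * (conj P * Q - P * conj Q) := by
      linear_combination (2 * A * B * σ * σ) * him +
        (A * B * (conj P * Q - P * conj Q)) * hσ2'
    rw [e, eq_div_iff (by simp [hA'])]
    simp only [map_add, map_mul, Complex.conj_ofReal]
    linear_combination (A : ℂ) ^ 2 * hP1 - (B : ℂ) ^ 2 * hQ1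
  have hs0 : (A * P + B * Q) ≠ 0 := Complex.normSq_pos.1 hs
  have h3 := mul_right_cancel₀ hs0 (h1.trans h2.symm)
  exact (starRingEnd ℂ).injective h3

theorem contDiff_complex_normSq : ContDiff ℝ ∞ (fun s : ℂ => Complex.normSq s) := by
  simp only [Complex.normSq_eq_norm_sq]
  exact contDiff_norm_sq ℝ

theorem contDiff_triangleDisc : ContDiff ℝ ∞ (triangleDisc A B) := by
  have := contDiff_complex_normSq
  unfold triangleDisc
  fun_prop

theorem contDiffAt_triangleDir (hA : 0 < A) (h : 0 < triangleDisc A B s) :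
    ContDiffAt ℝ ∞ (triangleDir σ A B) s := by
  have hs := normSq_pos_of_triangleDisc_pos h
  have h1 := contDiff_complex_normSq.contDiffAt (x := s)
  have h2 : ContDiffAt ℝ ∞ (fun s => √(triangleDisc A B s)) s :=
    contDiff_triangleDisc.contDiffAt.sqrt h.ne'
  have ofR : ∀ {f : ℂ → ℝ}, ContDiffAt ℝ ∞ f s → ContDiffAt ℝ ∞ (fun s => (f s : ℂ)) s :=
    fun hf => Complex.ofRealCLM.contDiff.contDiffAt.comp _ hf
  rw [← contDiffWithinAt_univ]
  refine ContDiffWithinAt.complex_div ?_ ?_ ?_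
  · rw [contDiffWithinAt_univ]
    refine contDiffAt_id.mul ((ofR ?_).sub ((ofR ?_).mul contDiffAt_const))
    · exact (h1.add contDiffAt_const).sub contDiffAt_const
    · exact contDiffAt_const.mul h2
  · rw [contDiffWithinAt_univ]
    exact ofR (contDiffAt_const.mul h1)
  · exact_mod_cast (by positivity : 2 * A * Complex.normSq s ≠ 0)

end Triangle

/-! ### The space of arms is a manifold -/

section Slice

open ComplexConjugate

/-- Directions of the legs `ℓ` of an arm reaching from the origin to the point `a`. -/
def armDirections {m : ℕ} (ℓ : Fin m → ℝ) (a : ℝ) : Set (Fin m → ℂ) :=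
  {q | (∀ k, ‖q k‖ = 1) ∧ ∑ k, (ℓ k : ℂ) * q k = a}

variable {m : ℕ} {ℓ : Fin m → ℝ} {a : ℝ}

theorem Complex.exp_arg_mul_I {z : ℂ} (hz : ‖z‖ = 1) : Complex.exp (z.arg * Complex.I) = z := by
  simpa [hz] using Complex.norm_mul_exp_arg_mul_I z

/-- If all legs were parallel they would be parallel to their sum `a`, hence equal to `±1`, and `a`
would be a signed sum of the lengths. -/
theorem exists_im_conj_mul_ne_zero (ha : 0 < a)
    (hgen : ∀ ε : Fin m → ℝ, (∀ k, ε k = 1 ∨ ε k = -1) → ∑ k, ε k * ℓ k ≠ a) {q : Fin m → ℂ}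
    (hq : q ∈ armDirections ℓ a) : ∃ i j, (conj (q i) * q j).im ≠ 0 := by
  by_contra! h
  have him : ∀ i, (q i).im = 0 := by
    intro i
    have h1 : (conj (q i) * ∑ k, (ℓ k : ℂ) * q k).im = 0 := by
      rw [Finset.mul_sum, Complex.im_sum]
      refine Finset.sum_eq_zero fun k _ => ?_
      rw [mul_left_comm, Complex.im_ofReal_mul, h, mul_zero]
    rw [hq.2, mul_comm, Complex.im_ofReal_mul, Complex.conj_im] at h1
    simpa [ha.ne'] using h1
  refine hgen (fun k => (q k).re) (fun k => ?_) ?_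
  · have := hq.1 k
    rw [← Complex.re_add_im (q k), him k] at this
    simp only [Complex.ofReal_zero, zero_mul, add_zero, Complex.norm_real, Real.norm_eq_abs] at this
    exact eq_or_eq_neg_of_abs_eq this
  · have := congrArg Complex.re hq.2
    rw [Complex.re_sum, Complex.ofReal_re] at this
    rw [← this]
    refine Finset.sum_congr rfl fun k _ => ?_
    rw [Complex.re_ofReal_mul, mul_comm]

/-- The part of the arm other than the legs `i`, `j`. -/
noncomputable def restVector (ℓ : Fin m → ℝ) (a : ℝ) (i j : Fin m) (q : Fin m → ℂ) : ℂ :=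
  a - ∑ k ∈ (Finset.univ.erase i).erase j, (ℓ k : ℂ) * q k

/-- Complete the directions of the legs other than `i`, `j` to the directions of an arm. -/
noncomputable def completeArm (ℓ : Fin m → ℝ) (a σ : ℝ) (i j : Fin m) (q : Fin m → ℂ) (k : Fin m) :
    ℂ :=
  if k = i then triangleDir σ (ℓ i) (ℓ j) (restVector ℓ a i j q)
  else if k = j then (restVector ℓ a i j q -
    ℓ i * triangleDir σ (ℓ i) (ℓ j) (restVector ℓ a i j q)) / ℓ j
  else q k

theorem sum_eq_add_add_sum_erase {i j : Fin m} (hij : i ≠ j) (f : Fin m → ℂ) :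
    ∑ k, f k = f i + f j + ∑ k ∈ (Finset.univ.erase i).erase j, f k := by
  rw [add_assoc, Finset.add_sum_erase _ _ (by simp [hij.symm]), Finset.add_sum_erase _ _ (by simp)]

theorem restVector_congr {i j : Fin m} {q q' : Fin m → ℂ} (h : ∀ k, k ≠ i → k ≠ j → q k = q' k) :
    restVector ℓ a i j q = restVector ℓ a i j q' := by
  unfold restVector
  congr 1
  refine Finset.sum_congr rfl fun k hk => ?_
  simp only [Finset.mem_erase, Finset.mem_univ, and_true] at hk
  rw [h k hk.2 hk.1]

theorem contDiff_restVector (i j : Fin m) : ContDiff ℝ ∞ (restVector ℓ a i j) := by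
  unfold restVector
  fun_prop

/-- Near an arm `p` with nonparallel legs `i` and `j`, the angles of the other legs relative to `p`
are coordinates, and these two legs close a triangle. The truncation in `m - 2` is harmless: a point
of the space supplies two distinct legs. -/
theorem exists_chartedSpace_armDirections (hℓ : ∀ k, 0 < ℓ k) (ha : 0 < a)
    (hgen : ∀ ε : Fin m → ℝ, (∀ k, ε k = 1 ∨ ε k = -1) → ∑ k, ε k * ℓ k ≠ a) :
    ∃ _ : ChartedSpace (EuclideanSpace ℝ (Fin (m - 2))) (armDirections ℓ a),
      IsManifold (𝓡 (m - 2)) ∞ (armDirections ℓ a) ∧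
      ContMDiff (𝓡 (m - 2)) 𝓘(ℝ, Fin m → ℂ) ∞ (Subtype.val : armDirections ℓ a → Fin m → ℂ) ∧
      ∀ ρ : (Fin m → ℂ) → armDirections ℓ a, (∀ x : armDirections ℓ a, ρ x.1 = x) →
        ContMDiffOn 𝓘(ℝ, Fin m → ℂ) (𝓡 (m - 2)) ∞ ρ (armDirections ℓ a) := by
  refine exists_chartedSpace_of_local_parametrizations _ fun p hp => ?_
  obtain ⟨i, j, hpij⟩ := exists_im_conj_mul_ne_zero ha hgen hp
  have hij : i ≠ j := by
    rintro rfl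
    rw [mul_comm, Complex.mul_conj] at hpij
    exact hpij (Complex.ofReal_im _)
  obtain ⟨σ, hσ, hσp⟩ : ∃ σ : ℝ, (σ = 1 ∨ σ = -1) ∧ 0 < σ * (conj (p i) * p j).im := by
    rcases hpij.lt_or_gt with h | h
    · exact ⟨-1, Or.inr rfl, by linarith⟩
    · exact ⟨1, Or.inl rfl, by linarith⟩
  have hcard : Fintype.card {k : Fin m // k ≠ i ∧ k ≠ j} = m - 2 := by
    rw [Fintype.card_subtype]
    have : (Finset.univ.filter fun k : Fin m => k ≠ i ∧ k ≠ j) = Finset.univ \ {i, j} := by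
      ext k; simp
    rw [this, Finset.card_sdiff_of_subset (Finset.subset_univ _), Finset.card_pair hij]
    simp
  let e : {k : Fin m // k ≠ i ∧ k ≠ j} ≃ Fin (m - 2) := Fintype.equivFinOfCardEq hcard
  have hp0 : ∀ k, p k ≠ 0 := fun k h => by
    have := hp.1 k
    simp [h] at this
  let free : EuclideanSpace ℝ (Fin (m - 2)) → Fin m → ℂ := fun y k =>
    if h : k ≠ i ∧ k ≠ j then p k * Complex.exp ((y (e ⟨k, h⟩) : ℂ) * Complex.I) else 0
  -- The first condition fixes the orientation of the triangle; the slit plane keeps the angles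
  -- relative to `p` away from `π`, where the logarithm jumps.
  let S : Set (Fin m → ℂ) := {q | 0 < σ * (conj (q i) * q j).im ∧
    ∀ k : {k : Fin m // k ≠ i ∧ k ≠ j}, q k / p k ∈ Complex.slitPlane}
  let T : Set (EuclideanSpace ℝ (Fin (m - 2))) := {y | (∀ k, y k ∈ Ioo (-Real.pi) Real.pi) ∧
    0 < triangleDisc (ℓ i) (ℓ j) (restVector ℓ a i j (free y))}
  let c : (Fin m → ℂ) → EuclideanSpace ℝ (Fin (m - 2)) := fun q =>
    WithLp.toLp 2 fun k => (Complex.log (q (e.symm k) / p (e.symm k))).im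
  let g : EuclideanSpace ℝ (Fin (m - 2)) → Fin m → ℂ := fun y => completeArm ℓ a σ i j (free y)
  have hfree : ContDiff ℝ ∞ free := by
    rw [contDiff_pi]
    intro k
    by_cases h : k ≠ i ∧ k ≠ j
    · simp only [free, dif_pos h]
      have h1 : ContDiff ℝ ∞ (fun y : EuclideanSpace ℝ (Fin (m - 2)) => ((y (e ⟨k, h⟩) : ℝ) : ℂ)) :=
        Complex.ofRealCLM.contDiff.comp (by fun_prop)
      exact contDiff_const.mul (h1.mul contDiff_const).cexp
    · simp only [free, dif_neg h]
      exact contDiff_const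
  have hrest : ∀ q ∈ armDirections ℓ a, restVector ℓ a i j q = ℓ i * q i + ℓ j * q j := by
    intro q hq
    rw [restVector, ← hq.2, sum_eq_add_add_sum_erase hij]
    ring
  have hfc : ∀ q ∈ armDirections ℓ a ∩ S, ∀ k, k ≠ i → k ≠ j → free (c q) k = q k := by
    intro q hq k hki hkj
    simp only [free, dif_pos (And.intro hki hkj), c, Equiv.symm_apply_apply, Complex.log_im]
    have h1 : ‖q k / p k‖ = 1 := by rw [norm_div, hq.1.1, hp.1, div_one]
    rw [Complex.exp_arg_mul_I h1, mul_div_cancel₀ _ (hp0 k)]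
  have hcf : ∀ y, (∀ k, y k ∈ Ioo (-Real.pi) Real.pi) → ∀ q : Fin m → ℂ,
      (∀ k, k ≠ i → k ≠ j → q k = free y k) → c q = y := by
    intro y hy q hq
    ext k
    have h1 := hq (e.symm k) (e.symm k).2.1 (e.symm k).2.2
    simp only [free, dif_pos (e.symm k).2] at h1
    simp only [c]
    rw [h1, mul_div_cancel_left₀ _ (hp0 _), Complex.log_exp]
    · simp
    · simpa using (hy k).1
    · simpa using (hy k).2.le
  refine ⟨S, T, c, g, ?_, ?_, ?_, ?_, ?_, ?_, ?_, ?_, ?_⟩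
  · have h1 : IsOpen {q : Fin m → ℂ | 0 < σ * (conj (q i) * q j).im} :=
      isOpen_lt continuous_const (continuous_const.mul (Complex.continuous_im.comp
        ((Complex.continuous_conj.comp (continuous_apply i)).mul (continuous_apply j))))
    have h2 : IsOpen (⋂ k : {k : Fin m // k ≠ i ∧ k ≠ j},
        (fun q : Fin m → ℂ => q k / p k) ⁻¹' Complex.slitPlane) :=
      isOpen_iInter_of_finite fun k => Complex.isOpen_slitPlane.preimage (by fun_prop)
    have h3 : {q : Fin m → ℂ | 0 < σ * (conj (q i) * q j).im} ∩
        ⋂ k : {k : Fin m // k ≠ i ∧ k ≠ j}, (fun q : Fin m → ℂ => q k / p k) ⁻¹' Complex.slitPlane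
        = S := by
      ext q
      simp [S]
    exact h3 ▸ h1.inter h2
  · have h1 : IsOpen (⋂ k, (fun y : EuclideanSpace ℝ (Fin (m - 2)) => y k) ⁻¹'
        Ioo (-Real.pi) Real.pi) :=
      isOpen_iInter_of_finite fun k => isOpen_Ioo.preimage (by fun_prop)
    have h2 : IsOpen {y | 0 < triangleDisc (ℓ i) (ℓ j) (restVector ℓ a i j (free y))} :=
      isOpen_lt continuous_const (contDiff_triangleDisc.continuous.comp
        ((contDiff_restVector i j).continuous.comp hfree.continuous))
    have h3 : (⋂ k, (fun y : EuclideanSpace ℝ (Fin (m - 2)) => y k) ⁻¹'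
        Ioo (-Real.pi) Real.pi) ∩
        {y | 0 < triangleDisc (ℓ i) (ℓ j) (restVector ℓ a i j (free y))} = T := by
      ext y
      simp [T]
    exact h3 ▸ h1.inter h2
  · exact ⟨hσp, fun k => by rw [div_self (hp0 k)]; exact Complex.one_mem_slitPlane⟩
  · rw [contDiffOn_piLp]
    intro k q hq
    have h1 : ContDiffAt ℝ ∞ Complex.log (q (e.symm k) / p (e.symm k)) :=
      (Complex.contDiffAt_log (hq.2.2 (e.symm k))).restrict_scalars ℝ
    have h2 : ContDiffAt ℝ ∞ (fun q : Fin m → ℂ => q (e.symm k) / p (e.symm k)) q := by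
      simp only [div_eq_mul_inv]
      exact (contDiff_apply ℝ ℂ _).contDiffAt.mul contDiffAt_const
    exact (Complex.imCLM.contDiff.contDiffAt.comp q (h1.comp q h2)).contDiffWithinAt
  · intro y hy
    have h1 : ContDiffAt ℝ ∞ (fun y => restVector ℓ a i j (free y)) y :=
      ((contDiff_restVector i j).comp hfree).contDiffAt
    have h2 : ContDiffAt ℝ ∞ (fun y => triangleDir σ (ℓ i) (ℓ j) (restVector ℓ a i j (free y))) y :=
      ContDiffAt.comp (g := triangleDir σ (ℓ i) (ℓ j)) y (contDiffAt_triangleDir (hℓ i) hy.2) h1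
    refine (contDiffAt_pi.2 fun k => ?_).contDiffWithinAt
    by_cases hki : k = i
    · simpa only [g, completeArm, if_pos hki] using h2
    by_cases hkj : k = j
    · simp only [g, completeArm, if_neg hki, if_pos hkj, div_eq_mul_inv]
      exact (h1.sub (contDiffAt_const.mul h2)).mul contDiffAt_const
    · simpa only [g, completeArm, if_neg hki, if_neg hkj] using (contDiff_pi.1 hfree k).contDiffAt
  · intro q hq
    refine ⟨fun k => ?_, ?_⟩
    · simp only [c, Complex.log_im]
      have h1 := Complex.mem_slitPlane_iff_arg.1 (hq.2.2 (e.symm k))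
      exact ⟨Complex.neg_pi_lt_arg _, lt_of_le_of_ne (Complex.arg_le_pi _) h1.1⟩
    · rw [restVector_congr (hfc q hq), hrest q hq.1, triangleDisc_add (hq.1.1 i) (hq.1.1 j)]
      have h1 : (conj (q i) * q j).im ≠ 0 := fun h0 => by
        have := hq.2.1
        simp [h0] at this
      have := hℓ i
      have := hℓ j
      positivity
  · intro y hy
    have hji : j ≠ i := hij.symm
    have hj0 : (ℓ j : ℂ) ≠ 0 := by exact_mod_cast (hℓ j).ne'
    have h1 := normSq_triangleDir hσ (hℓ i) hy.2
    have h2 := normSq_sub_triangleDir hσ (hℓ i) hy.2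
    have h3 := im_conj_triangleDir_mul hσ (hℓ i) hy.2
    refine ⟨⟨fun k => ?_, ?_⟩, ?_, fun k => ?_⟩
    · by_cases hki : k = i
      · simp only [g, completeArm, if_pos hki]
        rw [← sq_eq_sq₀ (norm_nonneg _) zero_le_one, ← Complex.normSq_eq_norm_sq, h1, one_pow]
      by_cases hkj : k = j
      · simp only [g, completeArm, if_neg hki, if_pos hkj]
        rw [← sq_eq_sq₀ (norm_nonneg _) zero_le_one, ← Complex.normSq_eq_norm_sq,
          Complex.normSq_div, h2, Complex.normSq_ofReal, one_pow, ← pow_two,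
          div_self (pow_ne_zero 2 (hℓ j).ne')]
      · simp only [g, completeArm, if_neg hki, if_neg hkj, free, dif_pos (And.intro hki hkj)]
        rw [norm_mul, hp.1, Complex.norm_exp_ofReal_mul_I, one_mul]
    · have h4 : restVector ℓ a i j (g y) = restVector ℓ a i j (free y) :=
        restVector_congr fun k hki hkj => by simp only [g, completeArm, if_neg hki, if_neg hkj]
      have h5 : (ℓ i : ℂ) * g y i + ℓ j * g y j = restVector ℓ a i j (g y) := by
        rw [h4]
        simp only [g, completeArm, if_neg hji, if_true]
        rw [mul_div_cancel₀ _ hj0]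
        ring
      rw [sum_eq_add_add_sum_erase hij, h5, restVector]
      ring
    · simp only [g, completeArm, if_neg hji, if_true]
      rw [mul_div_assoc', Complex.div_ofReal_im, mul_div_assoc']
      exact div_pos h3 (hℓ j)
    · simp only [g, completeArm, if_neg k.2.1, if_neg k.2.2, free, dif_pos k.2]
      rw [mul_div_cancel_left₀ _ (hp0 _), Complex.mem_slitPlane_iff_arg, Complex.arg_exp_mul_I,
        (toIocMod_eq_self _).2]
      · exact ⟨(hy.1 _).2.ne, Complex.exp_ne_zero _⟩
      · have := hy.1 (e k)
        exact ⟨this.1, by linarith [this.2]⟩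
  · intro q hq
    have h1 : triangleDir σ (ℓ i) (ℓ j) (restVector ℓ a i j (free (c q))) = q i := by
      rw [restVector_congr (hfc q hq), hrest q hq.1]
      exact triangleDir_add hσ (hℓ i) (hℓ j) (hq.1.1 i) (hq.1.1 j) hq.2.1
    have hj0 : (ℓ j : ℂ) ≠ 0 := by exact_mod_cast (hℓ j).ne'
    funext k
    by_cases hki : k = i
    · simp only [g, completeArm, if_pos hki]
      rw [h1, hki]
    by_cases hkj : k = j
    · simp only [g, completeArm, if_neg hki, if_pos hkj]
      rw [h1, restVector_congr (hfc q hq), hrest q hq.1, add_sub_cancel_left,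
        mul_div_cancel_left₀ _ hj0, hkj]
    · simp only [g, completeArm, if_neg hki, if_neg hkj]
      exact hfc q hq k hki hkj
  · intro y hy
    exact hcf y hy.1 _ fun k hki hkj => by simp only [g, completeArm, if_neg hki, if_neg hkj]

end Slice

/-! ### Proper motions of the plane as maps `z ↦ ζ z + c` -/

section Motions

theorem IsProperMotion.exists_eq {g : ℂ ≃ᵃⁱ[ℝ] ℂ} (hg : IsProperMotion g) :
    ∃ ζ c : ℂ, ‖ζ‖ = 1 ∧ ∀ z, g z = ζ * z + c := by
  have hz : ∀ z, g z = g.linearIsometryEquiv z + g 0 := by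
    intro z
    have := g.map_vadd 0 z
    simpa using this
  obtain ⟨ζ, h | h⟩ := linear_isometry_complex g.linearIsometryEquiv
  · exact ⟨ζ, g 0, ζ.norm_coe, fun z => by rw [hz, h, rotation_apply]⟩
  · exfalso
    unfold IsProperMotion at hg
    have e : ((g.linearIsometryEquiv).toLinearEquiv : ℂ →ₗ[ℝ] ℂ) =
        ((rotation ζ).toLinearEquiv : ℂ →ₗ[ℝ] ℂ) ∘ₗ
          (Complex.conjLIE.toLinearEquiv : ℂ →ₗ[ℝ] ℂ) := by
      rw [h]; rfl
    rw [e, LinearMap.det_comp, det_rotation, Complex.det_conjLIE] at hg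
    norm_num at hg

theorem exists_isProperMotion {ζ : ℂ} (hζ : ‖ζ‖ = 1) (c : ℂ) :
    ∃ g : ℂ ≃ᵃⁱ[ℝ] ℂ, IsProperMotion g ∧ ∀ z, g z = ζ * z + c := by
  let ζ' : Circle := ⟨ζ, by simpa [Submonoid.unitSphere] using hζ⟩
  refine ⟨(rotation ζ').toAffineIsometryEquiv.trans (AffineIsometryEquiv.constVAdd ℝ ℂ c), ?_,
    fun z => ?_⟩
  · have e : ((((rotation ζ').toAffineIsometryEquiv.trans
        (AffineIsometryEquiv.constVAdd ℝ ℂ c)).linearIsometryEquiv).toLinearEquiv : ℂ →ₗ[ℝ] ℂ) =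
        ((rotation ζ').toLinearEquiv : ℂ →ₗ[ℝ] ℂ) := rfl
    rw [IsProperMotion, e, det_rotation]
    exact one_pos
  · have h : rotation ζ' z = ζ * z := rotation_apply ζ' z
    simp [h, add_comm]

theorem configSetoid_iff {m : ℕ} {A : Set (Fin (m + 1) → ℝ)} (z w : configSet A) :
    configSetoid A z w ↔ ∃ ζ c : ℂ, ‖ζ‖ = 1 ∧ ∀ i, w.1 i = ζ * z.1 i + c := by
  constructor
  · rintro ⟨g, hg, h⟩
    obtain ⟨ζ, c, hζ, hgz⟩ := hg.exists_eq
    exact ⟨ζ, c, hζ, fun i => by rw [h i, hgz]⟩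
  · rintro ⟨ζ, c, hζ, h⟩
    obtain ⟨g, hg, hgz⟩ := exists_isProperMotion hζ c
    exact ⟨g, hg, fun i => by rw [h i, hgz]⟩

end Motions

/-! ### Polygons, their directions, and stability along the telescopic leg -/

section Linkage

open ComplexConjugate

variable {m : ℕ} {ℓ : Fin m → ℝ} {a b s t : ℝ}

@[simp]
theorem lengthVector_castSucc (k : Fin m) : lengthVector ℓ t k.castSucc = ℓ k := by
  simp [lengthVector]

@[simp]
theorem lengthVector_last : lengthVector ℓ t (Fin.last m) = t := by
  simp [lengthVector]

theorem lengthVector_pos (hℓ : ∀ k, 0 < ℓ k) (ht : 0 < t) (i : Fin (m + 1)) :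
    0 < lengthVector ℓ t i := by
  induction i using Fin.lastCases with
  | last => simpa
  | cast k => simpa using hℓ k

theorem mem_telescopicData_iff {x : Fin (m + 1) → ℝ} :
    x ∈ telescopicData ℓ a b ↔ x (Fin.last m) ∈ Icc a b ∧ x = lengthVector ℓ (x (Fin.last m)) := by
  constructor
  · intro h
    refine ⟨by simpa using h (Fin.last m), ?_⟩
    funext i
    induction i using Fin.lastCases with
    | last => simp
    | cast k =>
      have := h k.castSucc
      simp only [lengthVector_castSucc] at this ⊢
      exact le_antisymm this.2 this.1
  · rintro ⟨h, hx⟩ i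
    induction i using Fin.lastCases with
    | last => simpa using h
    | cast k =>
      rw [hx]
      simp

theorem lengthVector_mem_telescopicData (ht : t ∈ Icc a b) :
    lengthVector ℓ t ∈ telescopicData ℓ a b := by
  rw [mem_telescopicData_iff]
  simpa using ht

theorem abs_sum_lengthVector_sub_le {ε : Fin (m + 1) → ℝ} (hε : IsSignVector ε) :
    |∑ i, ε i * lengthVector ℓ t i - ∑ i, ε i * lengthVector ℓ s i| = |t - s| := by
  rw [Fin.sum_univ_castSucc, Fin.sum_univ_castSucc]
  simp only [lengthVector_castSucc, lengthVector_last]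
  rw [add_sub_add_left_eq_sub, ← mul_sub, abs_mul]
  rcases hε (Fin.last m) with h | h <;> simp [h]

/-- Within the range of the telescopic leg, the closed configurations are stable for all lengths of
the leg. -/
theorem isStableConfig_of_closed (hℓ : ∀ k, 0 < ℓ k) (ha : 0 < a)
    (hdiff : b - a < bracket (lengthVector ℓ a)) (hs : s ∈ Icc a b) (ht : t ∈ Icc a b)
    {u : Fin (m + 1) → ℂ} (hu : ∀ i, ‖u i‖ = 1) (h0 : ∑ i, (lengthVector ℓ s i : ℂ) * u i = 0) :
    IsStableConfig (lengthVector ℓ t) u := by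
  classical
  intro ζ hζ
  convert_to ∑ i, (if u i = ζ then (1 : ℝ) else -1) * lengthVector ℓ t i < 0
  set ε : Fin (m + 1) → ℝ := fun i => if u i = ζ then 1 else -1 with hε
  have hsign : IsSignVector ε := fun i => by
    by_cases h : u i = ζ <;> simp [hε, h]
  have hpos := lengthVector_pos (t := s) hℓ (ha.trans_le hs.1)
  -- Project the closing condition to the direction `ζ`: points at `ζ` contribute their full length,
  -- the others at least minus their length.
  have hS : ∑ i, ε i * lengthVector ℓ s i ≤ 0 := by
    have h1 : ∑ i, ε i * lengthVector ℓ s i ≤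
        ∑ i, (lengthVector ℓ s i) * (u i * conj ζ).re := by
      refine Finset.sum_le_sum fun i _ => ?_
      by_cases h : u i = ζ
      · simp only [hε, if_pos h]
        rw [h, Complex.mul_conj_of_norm_eq_one hζ]
        simp
      · simp only [hε, if_neg h]
        have h2 : |(u i * conj ζ).re| ≤ 1 := by
          refine (Complex.abs_re_le_norm _).trans ?_
          rw [norm_mul, hu i, RCLike.norm_conj, hζ, one_mul]
        nlinarith [hpos i, (abs_le.1 h2).1]
    have h2 : ∑ i, (lengthVector ℓ s i) * (u i * conj ζ).re = 0 := by
      have h3 : ((∑ i, (lengthVector ℓ s i : ℂ) * u i) * conj ζ).re = 0 := by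
        rw [h0]; simp
      rw [Finset.sum_mul, Complex.re_sum] at h3
      rw [← h3]
      refine Finset.sum_congr rfl fun i _ => ?_
      rw [mul_assoc, Complex.re_ofReal_mul]
    exact h1.trans h2.le
  have hsa := abs_sum_lengthVector_sub_le (ℓ := ℓ) (s := a) (t := s) hsign
  have hta := abs_sum_lengthVector_sub_le (ℓ := ℓ) (s := a) (t := t) hsign
  rw [abs_of_nonneg (sub_nonneg.2 hs.1)] at hsa
  rw [abs_of_nonneg (sub_nonneg.2 ht.1)] at hta
  have hleast := bracket_isLeast (lengthVector ℓ a)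
  have hlow := hleast.2
  -- At `a` the signed sum is at least the bracket or at most minus the bracket. The first would
  -- leave it positive at `s`, against `hS`; the second leaves it negative at `t`.
  rcases le_or_gt 0 (∑ i, ε i * lengthVector ℓ a i) with h | h
  · have h1 := hlow ⟨h, ε, hsign, rfl⟩
    have h2 := (abs_le.1 hsa.le).1
    linarith [hs.2]
  · have h1 : bracket (lengthVector ℓ a) ≤ -∑ i, ε i * lengthVector ℓ a i := by
      refine hlow ⟨by linarith, fun i => -ε i, fun i => ?_, ?_⟩
      · rcases hsign i with h | h <;> simp [h]
      · simp
    have h2 := (abs_le.1 hta.le).2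
    linarith [ht.2]

/-- The polygon with first vertex `0` and sides of given lengths and directions. -/
noncomputable def polygon (l : Fin (m + 1) → ℝ) (u : Fin (m + 1) → ℂ) (i : Fin (m + 1)) : ℂ :=
  ∑ k : Fin m, if k.castSucc < i then (l k.castSucc : ℂ) * u k.castSucc else 0

theorem polygon_add_one_sub {l : Fin (m + 1) → ℝ} {u : Fin (m + 1) → ℂ}
    (h : ∑ i, (l i : ℂ) * u i = 0) (i : Fin (m + 1)) :
    polygon l u (i + 1) - polygon l u i = l i * u i := by
  induction i using Fin.lastCases with
  | last =>
    rw [Fin.sum_univ_castSucc] at h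
    simp only [polygon, Fin.last_add_one, Fin.castSucc_lt_last, if_true, Fin.not_lt_zero, if_false,
      Finset.sum_const_zero]
    linear_combination -h
  | cast j =>
    simp only [polygon, Fin.coeSucc_eq_succ]
    rw [← Finset.sum_sub_distrib, Finset.sum_eq_single j]
    · simp
    · intro k _ hk
      have : k.castSucc < j.succ ↔ k.castSucc < j.castSucc := by
        rw [Fin.lt_def, Fin.lt_def]
        have : (k : ℕ) ≠ j := fun h => hk (Fin.ext h)
        simp only [Fin.val_castSucc, Fin.val_succ]
        omega
      simp [this]
    · simp

theorem sub_eq_sub_of_add_one_sub {f g : Fin (m + 1) → ℂ}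
    (h : ∀ i, f (i + 1) - f i = g (i + 1) - g i) (i : Fin (m + 1)) : f i - g i = f 0 - g 0 := by
  induction i using Fin.induction with
  | zero => rfl
  | succ j ih =>
    have := h j.castSucc
    rw [Fin.coeSucc_eq_succ] at this
    linear_combination this + ih

/-- The directions of the sides of a polygon. -/
noncomputable def directions (z : Fin (m + 1) → ℂ) (i : Fin (m + 1)) : ℂ :=
  (z (i + 1) - z i) / (sideLengths z i : ℂ)

theorem sum_sideLengths_mul_directions (z : Fin (m + 1) → ℂ) (h : ∀ i, sideLengths z i ≠ 0) :
    ∑ i, (sideLengths z i : ℂ) * directions z i = 0 := by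
  have h1 : ∀ i, (sideLengths z i : ℂ) * directions z i = z (i + 1) - z i := fun i =>
    mul_div_cancel₀ _ (by exact_mod_cast h i)
  rw [Finset.sum_congr rfl fun i _ => h1 i, Finset.sum_sub_distrib, sub_eq_zero]
  exact Equiv.sum_comp (Equiv.addRight 1) z

theorem norm_directions {z : Fin (m + 1) → ℂ} {i : Fin (m + 1)} (h : sideLengths z i ≠ 0) :
    ‖directions z i‖ = 1 := by
  rw [directions, norm_div, Complex.norm_real, Real.norm_of_nonneg (show 0 ≤ sideLengths z i from norm_nonneg _)]
  exact div_self h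

/-- The directions of the legs after moving the configuration to the position in which the last leg
has length `a` and direction `-1`. -/
noncomputable def normalDirections (ℓ : Fin m → ℝ) (a : ℝ) (z : Fin (m + 1) → ℂ) (k : Fin m) : ℂ :=
  -balance (lengthVector ℓ a) (directions z) k.castSucc *
    conj (balance (lengthVector ℓ a) (directions z) (Fin.last m))

/-- The configuration with last leg of length `t` that is determined by the directions of an arm. -/
noncomputable def armConfig (ℓ : Fin m → ℝ) (t : ℝ) (q : Fin m → ℂ) : Fin (m + 1) → ℂ :=
  polygon (lengthVector ℓ t)
    (balance (lengthVector ℓ t) (Fin.snoc (α := fun _ => ℂ) q (-1)))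

theorem discEquiv_balance {p : (Fin (m + 1) → ℝ) × (Fin (m + 1) → ℂ)}
    (hp : p ∈ stableData (Fin (m + 1))) : DiscEquiv p.2 (balance p.1 p.2) :=
  DiscEquiv.of_discAut (conformalBarycenter_spec hp).1

end Linkage

/-! ### Closed polygons correspond to pairs of an arm and a last length -/

section Correspondence

open ComplexConjugate

variable {m : ℕ} {ℓ : Fin m → ℝ} {a b s t : ℝ}

theorem sideLengths_pos (hℓ : ∀ k, 0 < ℓ k) (ha : 0 < a) {z : Fin (m + 1) → ℂ}
    (hz : z ∈ configSet (telescopicData ℓ a b)) (i : Fin (m + 1)) : 0 < sideLengths z i := by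
  obtain ⟨h1, h2⟩ := mem_telescopicData_iff.1 hz
  rw [h2]
  exact lengthVector_pos hℓ (ha.trans_le h1.1) i

theorem mem_stableData_of_closed (hℓ : ∀ k, 0 < ℓ k) (ha : 0 < a)
    (hdiff : b - a < bracket (lengthVector ℓ a)) (hs : s ∈ Icc a b) (ht : t ∈ Icc a b)
    {u : Fin (m + 1) → ℂ} (hu : ∀ i, ‖u i‖ = 1) (h0 : ∑ i, (lengthVector ℓ s i : ℂ) * u i = 0) :
    (lengthVector ℓ t, u) ∈ stableData (Fin (m + 1)) :=
  ⟨lengthVector_pos hℓ (ha.trans_le ht.1), hu, isStableConfig_of_closed hℓ ha hdiff hs ht hu h0⟩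

theorem sum_lengthVector_mul_directions (hℓ : ∀ k, 0 < ℓ k) (ha : 0 < a) {z : Fin (m + 1) → ℂ}
    (hz : z ∈ configSet (telescopicData ℓ a b)) :
    ∑ i, (lengthVector ℓ (sideLengths z (Fin.last m)) i : ℂ) * directions z i = 0 := by
  rw [← (mem_telescopicData_iff.1 hz).2]
  exact sum_sideLengths_mul_directions z fun i => (sideLengths_pos hℓ ha hz i).ne'

theorem directions_mem_stableData (hℓ : ∀ k, 0 < ℓ k) (ha : 0 < a)
    (hdiff : b - a < bracket (lengthVector ℓ a)) (ht : t ∈ Icc a b) {z : Fin (m + 1) → ℂ}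
    (hz : z ∈ configSet (telescopicData ℓ a b)) :
    (lengthVector ℓ t, directions z) ∈ stableData (Fin (m + 1)) :=
  mem_stableData_of_closed hℓ ha hdiff (mem_telescopicData_iff.1 hz).1 ht
    (fun i => norm_directions (sideLengths_pos hℓ ha hz i).ne')
    (sum_lengthVector_mul_directions hℓ ha hz)

/-- The directions of the legs of the configuration, in normal position, are closed. -/
theorem snoc_normal {q : Fin m → ℂ} (hq : q ∈ armDirections ℓ a) :
    (∀ i, ‖(Fin.snoc (α := fun _ => ℂ) q (-1) : Fin (m + 1) → ℂ) i‖ = 1) ∧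
    ∑ i, (lengthVector ℓ a i : ℂ) * (Fin.snoc (α := fun _ => ℂ) q (-1) : Fin (m + 1) → ℂ) i = 0 := by
  constructor
  · intro i
    induction i using Fin.lastCases with
    | last => simp
    | cast k => simpa using hq.1 k
  · rw [Fin.sum_univ_castSucc]
    simp [hq.2]

theorem snoc_mem_stableData (hℓ : ∀ k, 0 < ℓ k) (ha : 0 < a)
    (hdiff : b - a < bracket (lengthVector ℓ a)) (ht : t ∈ Icc a b) {q : Fin m → ℂ}
    (hq : q ∈ armDirections ℓ a) :
    (lengthVector ℓ t, (Fin.snoc (α := fun _ => ℂ) q (-1) : Fin (m + 1) → ℂ)) ∈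
      stableData (Fin (m + 1)) :=
  mem_stableData_of_closed hℓ ha hdiff ⟨le_rfl, ht.1.trans ht.2⟩ ht (snoc_normal hq).1
    (snoc_normal hq).2

/-- The last entry `-1` reveals the rotation `ζ`, which the normalization then cancels. -/
theorem normalDirections_eq_of_rotation {ζ : ℂ} (hζ : ‖ζ‖ = 1) {z : Fin (m + 1) → ℂ}
    {q : Fin m → ℂ} (h : ∀ i, balance (lengthVector ℓ a) (directions z) i =
      ζ * (Fin.snoc (α := fun _ => ℂ) q (-1) : Fin (m + 1) → ℂ) i) :
    normalDirections ℓ a z = q := by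
  funext k
  rw [normalDirections, h, h, Fin.snoc_castSucc, Fin.snoc_last]
  simp only [map_mul, map_neg, map_one]
  linear_combination (q k) * Complex.mul_conj_of_norm_eq_one hζ

theorem balance_eq_rotation_snoc (hℓ : ∀ k, 0 < ℓ k) (ha : 0 < a) (hab : a ≤ b)
    (hdiff : b - a < bracket (lengthVector ℓ a)) {z : Fin (m + 1) → ℂ}
    (hz : z ∈ configSet (telescopicData ℓ a b)) :
    ∃ ζ : ℂ, ‖ζ‖ = 1 ∧ ∀ i, (Fin.snoc (α := fun _ => ℂ) (normalDirections ℓ a z) (-1) :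
      Fin (m + 1) → ℂ) i = ζ * balance (lengthVector ℓ a) (directions z) i := by
  have hd := directions_mem_stableData hℓ ha hdiff (left_mem_Icc.2 hab) hz
  have hu := (discEquiv_balance hd).norm_eq hd.2.1
  refine ⟨-conj (balance (lengthVector ℓ a) (directions z) (Fin.last m)), ?_, fun i => ?_⟩
  · rw [norm_neg, RCLike.norm_conj, hu]
  · induction i using Fin.lastCases with
    | last =>
      rw [Fin.snoc_last, neg_mul, mul_comm, Complex.mul_conj_of_norm_eq_one (hu _)]
    | cast k =>
      rw [Fin.snoc_castSucc, normalDirections]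
      ring

theorem normalDirections_mem (hℓ : ∀ k, 0 < ℓ k) (ha : 0 < a) (hab : a ≤ b)
    (hdiff : b - a < bracket (lengthVector ℓ a)) {z : Fin (m + 1) → ℂ}
    (hz : z ∈ configSet (telescopicData ℓ a b)) : normalDirections ℓ a z ∈ armDirections ℓ a := by
  have hd := directions_mem_stableData hℓ ha hdiff (left_mem_Icc.2 hab) hz
  have hu := (discEquiv_balance hd).norm_eq hd.2.1
  obtain ⟨ζ, hζ, h⟩ := balance_eq_rotation_snoc hℓ ha hab hdiff hz
  constructor
  · intro k
    have := h k.castSucc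
    rw [Fin.snoc_castSucc] at this
    rw [this, norm_mul, hζ, hu, one_mul]
  · have h0 := (conformalBarycenter_spec hd).2
    have h1 : ∑ i, (lengthVector ℓ a i : ℂ) *
        (Fin.snoc (α := fun _ => ℂ) (normalDirections ℓ a z) (-1) : Fin (m + 1) → ℂ) i = 0 := by
      have : ζ * ∑ i, (lengthVector ℓ a i : ℂ) * balance (lengthVector ℓ a) (directions z) i = 0 := by
        rw [h0, mul_zero]
      rw [← this, Finset.mul_sum]
      exact Finset.sum_congr rfl fun i _ => by rw [h i]; ring
    rw [Fin.sum_univ_castSucc] at h1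
    simp only [lengthVector_castSucc, Fin.snoc_castSucc, lengthVector_last, Fin.snoc_last] at h1
    linear_combination h1

theorem armConfig_add_one_sub (hℓ : ∀ k, 0 < ℓ k) (ha : 0 < a)
    (hdiff : b - a < bracket (lengthVector ℓ a)) (ht : t ∈ Icc a b) {q : Fin m → ℂ}
    (hq : q ∈ armDirections ℓ a) (i : Fin (m + 1)) :
    armConfig ℓ t q (i + 1) - armConfig ℓ t q i = lengthVector ℓ t i *
      balance (lengthVector ℓ t) (Fin.snoc (α := fun _ => ℂ) q (-1)) i :=
  polygon_add_one_sub (conformalBarycenter_spec (snoc_mem_stableData hℓ ha hdiff ht hq)).2 i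

theorem sideLengths_armConfig (hℓ : ∀ k, 0 < ℓ k) (ha : 0 < a)
    (hdiff : b - a < bracket (lengthVector ℓ a)) (ht : t ∈ Icc a b) {q : Fin m → ℂ}
    (hq : q ∈ armDirections ℓ a) : sideLengths (armConfig ℓ t q) = lengthVector ℓ t := by
  funext i
  have hd := snoc_mem_stableData hℓ ha hdiff ht hq
  have hpos := lengthVector_pos hℓ (ha.trans_le ht.1) i
  rw [sideLengths, armConfig_add_one_sub hℓ ha hdiff ht hq, norm_mul,
    (discEquiv_balance hd).norm_eq hd.2.1, mul_one, Complex.norm_real, Real.norm_of_nonneg hpos.le]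

theorem armConfig_mem (hℓ : ∀ k, 0 < ℓ k) (ha : 0 < a)
    (hdiff : b - a < bracket (lengthVector ℓ a)) (ht : t ∈ Icc a b) {q : Fin m → ℂ}
    (hq : q ∈ armDirections ℓ a) : armConfig ℓ t q ∈ configSet (telescopicData ℓ a b) := by
  rw [configSet, mem_preimage, sideLengths_armConfig hℓ ha hdiff ht hq]
  exact lengthVector_mem_telescopicData ht

theorem directions_armConfig (hℓ : ∀ k, 0 < ℓ k) (ha : 0 < a)
    (hdiff : b - a < bracket (lengthVector ℓ a)) (ht : t ∈ Icc a b) {q : Fin m → ℂ}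
    (hq : q ∈ armDirections ℓ a) : directions (armConfig ℓ t q) =
      balance (lengthVector ℓ t) (Fin.snoc (α := fun _ => ℂ) q (-1)) := by
  funext i
  have hpos := lengthVector_pos hℓ (ha.trans_le ht.1) i
  rw [directions, sideLengths_armConfig hℓ ha hdiff ht hq, armConfig_add_one_sub hℓ ha hdiff ht hq,
    mul_div_cancel_left₀ _ (by exact_mod_cast hpos.ne')]

/-- Balancing for `t` and then for `a` stays in the disc orbit of `(q, -1)`, which is already closed
for `a`; so the result is a rotation of it. -/
theorem normalDirections_armConfig (hℓ : ∀ k, 0 < ℓ k) (ha : 0 < a)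
    (hdiff : b - a < bracket (lengthVector ℓ a)) (ht : t ∈ Icc a b) {q : Fin m → ℂ}
    (hq : q ∈ armDirections ℓ a) : normalDirections ℓ a (armConfig ℓ t q) = q := by
  have hta : a ∈ Icc a b := ⟨le_rfl, ht.1.trans ht.2⟩
  have hz := armConfig_mem hℓ ha hdiff ht hq
  have hd := directions_mem_stableData hℓ ha hdiff hta hz
  have hv := snoc_mem_stableData hℓ ha hdiff ht hq
  have hv' := snoc_mem_stableData hℓ ha hdiff hta hq
  have h1 := discEquiv_balance hv
  have h2 := discEquiv_balance hd
  simp only at h1 h2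
  rw [← directions_armConfig hℓ ha hdiff ht hq] at h1
  obtain ⟨ζ, hζ, h⟩ := (h1.trans hv.2.1 h2).exists_rotation hv'.1 hv'.2.1 hv'.2.2
    (snoc_normal hq).2 (conformalBarycenter_spec hd).2
  exact normalDirections_eq_of_rotation hζ h

/-- Both polygons have last length `t`, and their directions lie in one disc orbit. The directions
thus differ by a rotation, and the polygons by a motion. -/
theorem exists_eq_armConfig (hℓ : ∀ k, 0 < ℓ k) (ha : 0 < a) (hab : a ≤ b)
    (hdiff : b - a < bracket (lengthVector ℓ a)) {z : Fin (m + 1) → ℂ}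
    (hz : z ∈ configSet (telescopicData ℓ a b)) : ∃ ζ c : ℂ, ‖ζ‖ = 1 ∧ ∀ i, z i = ζ *
      armConfig ℓ (sideLengths z (Fin.last m)) (normalDirections ℓ a z) i + c := by
  have ht := (mem_telescopicData_iff.1 hz).1
  have hd := directions_mem_stableData hℓ ha hdiff (left_mem_Icc.2 hab) hz
  have hdt := directions_mem_stableData hℓ ha hdiff ht hz
  have hq := normalDirections_mem hℓ ha hab hdiff hz
  have hv := snoc_mem_stableData hℓ ha hdiff ht hq
  obtain ⟨ζ, hζ, h⟩ := balance_eq_rotation_snoc hℓ ha hab hdiff hz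
  have h1 := discEquiv_balance hd
  have h2 := discEquiv_balance hv
  simp only at h1 h2
  have h3 := (h1.trans hd.2.1 (DiscEquiv.of_rotation hζ h)).trans hd.2.1 h2
  obtain ⟨ξ, hξ, h4⟩ := h3.exists_rotation hdt.1 hdt.2.1 hdt.2.2
    (sum_lengthVector_mul_directions hℓ ha hz) (conformalBarycenter_spec hv).2
  have hξ' := Complex.mul_conj_of_norm_eq_one hξ
  set R := armConfig ℓ (sideLengths z (Fin.last m)) (normalDirections ℓ a z) with hR
  have h5 : ∀ i, z (i + 1) - z i = conj ξ * R (i + 1) - conj ξ * R i := by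
    intro i
    have h6 : z (i + 1) - z i =
        (lengthVector ℓ (sideLengths z (Fin.last m)) i : ℂ) * directions z i := by
      rw [← (mem_telescopicData_iff.1 hz).2, directions]
      exact (mul_div_cancel₀ _ (by exact_mod_cast (sideLengths_pos hℓ ha hz i).ne')).symm
    rw [← mul_sub, hR, armConfig_add_one_sub hℓ ha hdiff ht hq, h4, h6]
    linear_combination (-(lengthVector ℓ (sideLengths z (Fin.last m)) i : ℂ) * directions z i) * hξ'
  refine ⟨conj ξ, z 0 - conj ξ * R 0, by rwa [RCLike.norm_conj], fun i => ?_⟩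
  linear_combination sub_eq_sub_of_add_one_sub (f := z) (g := fun i => conj ξ * R i) h5 i

theorem sideLengths_motion {ζ c : ℂ} (hζ : ‖ζ‖ = 1) {z w : Fin (m + 1) → ℂ}
    (h : ∀ i, w i = ζ * z i + c) : sideLengths w = sideLengths z := by
  funext i
  rw [sideLengths, sideLengths, h, h, add_sub_add_right_eq_sub, ← mul_sub, norm_mul, hζ, one_mul]

/-- A motion rotates the directions, so the disc orbit is unchanged, and its closed representative
for `a` with last direction `-1` is unique. -/
theorem normalDirections_motion (hℓ : ∀ k, 0 < ℓ k) (ha : 0 < a) (hab : a ≤ b)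
    (hdiff : b - a < bracket (lengthVector ℓ a)) {ζ c : ℂ} (hζ : ‖ζ‖ = 1) {z w : Fin (m + 1) → ℂ}
    (hz : z ∈ configSet (telescopicData ℓ a b)) (h : ∀ i, w i = ζ * z i + c) :
    normalDirections ℓ a w = normalDirections ℓ a z := by
  have hw : w ∈ configSet (telescopicData ℓ a b) := by
    rw [configSet, mem_preimage, sideLengths_motion hζ h]
    exact hz
  have hdir : ∀ i, directions w i = ζ * directions z i := by
    intro i
    rw [directions, directions, sideLengths_motion hζ h, h, h, mul_div_assoc']
    congr 1
    ring
  have hta := left_mem_Icc.2 hab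
  have hd := directions_mem_stableData hℓ ha hdiff hta hz
  have hd' := directions_mem_stableData hℓ ha hdiff hta hw
  have hq := normalDirections_mem hℓ ha hab hdiff hz
  have hv := snoc_mem_stableData hℓ ha hdiff hta hq
  obtain ⟨ξ, hξ, h1⟩ := balance_eq_rotation_snoc hℓ ha hab hdiff hz
  have e1 := discEquiv_balance hd
  have e2 := discEquiv_balance hd'
  simp only at e1 e2
  have e3 := e1.trans hd.2.1 (DiscEquiv.of_rotation hξ h1)
  have e4 := (DiscEquiv.of_rotation hζ hdir).trans hd.2.1 e2
  obtain ⟨η, hη, h2⟩ := ((e3.symm hd.2.1).trans hv.2.1 e4).exists_rotation hv.1 hv.2.1 hv.2.2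
    (snoc_normal hq).2 (conformalBarycenter_spec hd').2
  exact normalDirections_eq_of_rotation hη h2

theorem contDiffOn_sideLengths (hℓ : ∀ k, 0 < ℓ k) (ha : 0 < a) (i : Fin (m + 1)) :
    ContDiffOn ℝ ∞ (fun z => sideLengths z i) (configSet (telescopicData ℓ a b)) := by
  intro z hz
  have h : ContDiffAt ℝ ∞ (fun z : Fin (m + 1) → ℂ => z (i + 1) - z i) z :=
    ((contDiff_apply ℝ ℂ _).sub (contDiff_apply ℝ ℂ _)).contDiffAt
  exact (h.norm ℝ (norm_pos_iff.1 (sideLengths_pos hℓ ha hz i))).contDiffWithinAt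

theorem contDiffOn_directions (hℓ : ∀ k, 0 < ℓ k) (ha : 0 < a) :
    ContDiffOn ℝ ∞ (directions (m := m)) (configSet (telescopicData ℓ a b)) := by
  rw [contDiffOn_pi]
  intro i z hz
  refine ContDiffWithinAt.complex_div ?_ ?_ ?_
  · exact ((contDiff_apply ℝ ℂ _).sub (contDiff_apply ℝ ℂ _)).contDiffWithinAt
  · exact Complex.ofRealCLM.contDiff.contDiffAt.comp_contDiffWithinAt z
      (contDiffOn_sideLengths hℓ ha i z hz)
  · exact_mod_cast (sideLengths_pos hℓ ha hz i).ne'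

theorem contDiffOn_normalDirections (hℓ : ∀ k, 0 < ℓ k) (ha : 0 < a) (hab : a ≤ b)
    (hdiff : b - a < bracket (lengthVector ℓ a)) :
    ContDiffOn ℝ ∞ (normalDirections ℓ a) (configSet (telescopicData ℓ a b)) := by
  have h1 : ContDiffOn ℝ ∞ (fun z => balance (lengthVector ℓ a) (directions z))
      (configSet (telescopicData ℓ a b)) :=
    contDiffOn_balance.comp (contDiffOn_const.prodMk (contDiffOn_directions hℓ ha))
      fun z hz => directions_mem_stableData hℓ ha hdiff (left_mem_Icc.2 hab) hz
  rw [contDiffOn_pi] at h1 ⊢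
  intro k
  exact (h1 k.castSucc).neg.mul (Complex.contDiff_conj.comp_contDiffOn (h1 (Fin.last m)))

theorem contDiff_lengthVector : ContDiff ℝ ∞ (lengthVector ℓ) := by
  rw [contDiff_pi]
  intro i
  induction i using Fin.lastCases with
  | last => simpa using contDiff_fun_id
  | cast k => simpa using contDiff_const

theorem contDiffOn_armConfig (hℓ : ∀ k, 0 < ℓ k) (ha : 0 < a)
    (hdiff : b - a < bracket (lengthVector ℓ a)) :
    ContDiffOn ℝ ∞ (fun p : (Fin m → ℂ) × ℝ => armConfig ℓ p.2 p.1)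
      (armDirections ℓ a ×ˢ Icc a b) := by
  have h0 : ContDiff ℝ ∞ (fun q : Fin m → ℂ =>
      (Fin.snoc (α := fun _ => ℂ) q (-1) : Fin (m + 1) → ℂ)) := by
    rw [contDiff_pi]
    intro i
    induction i using Fin.lastCases with
    | last => simpa using contDiff_const
    | cast k => simpa using contDiff_apply ℝ ℂ k
  have h1 : ContDiffOn ℝ ∞ (fun p : (Fin m → ℂ) × ℝ => balance (lengthVector ℓ p.2)
      (Fin.snoc (α := fun _ => ℂ) p.1 (-1))) (armDirections ℓ a ×ˢ Icc a b) :=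
    contDiffOn_balance.comp
      ((contDiff_lengthVector.comp contDiff_snd).prodMk (h0.comp contDiff_fst)).contDiffOn
      fun p hp => snoc_mem_stableData hℓ ha hdiff hp.2 hp.1
  rw [contDiffOn_pi] at h1 ⊢
  intro i
  simp only [armConfig, polygon]
  refine ContDiffOn.sum fun k _ => ?_
  by_cases h : k.castSucc < i
  · simp only [if_pos h, lengthVector_castSucc]
    exact contDiffOn_const.mul (h1 _)
  · simp only [if_neg h]
    exact contDiffOn_const

end Correspondence

/-! ### Assembly of the manifold structures and the diffeomorphism -/

theorem sum_ne_of_isGenericVector {m : ℕ} {ℓ : Fin m → ℝ} {a : ℝ}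
    (h : IsGenericVector (lengthVector ℓ a)) (ε : Fin m → ℝ) (hε : ∀ k, ε k = 1 ∨ ε k = -1) :
    ∑ k, ε k * ℓ k ≠ a := by
  intro h0
  refine h (Fin.snoc (α := fun _ => ℝ) ε (-1)) (fun i => ?_) ?_
  · induction i using Fin.lastCases with
    | last => simp
    | cast k => simpa using hε k
  · rw [Fin.sum_univ_castSucc]
    simp [h0]

theorem ModuliSpace.exists_isQuotientManifold_of_isEmpty {m : ℕ} (A : Set (Fin (m + 1) → ℝ))
    [IsEmpty (ModuliSpace A)] {E H : Type*} [NormedAddCommGroup E] [NormedSpace ℝ E]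
    [TopologicalSpace H] (I : ModelWithCorners ℝ E H) :
    ∃ _ : ChartedSpace H (ModuliSpace A), ModuliSpace.IsQuotientManifold A I := by
  let _ : ChartedSpace H (ModuliSpace A) := ChartedSpace.empty H (ModuliSpace A)
  refine ⟨inferInstance, inferInstance, fun U _ f => ⟨fun _ => ⟨0, contDiffOn_const, ?_⟩, ?_⟩⟩
  · exact fun w => isEmptyElim (mk A w)
  · exact fun _ x => isEmptyElim x

theorem configSet_singleton_subset {m : ℕ} {ℓ : Fin m → ℝ} {a b : ℝ} (hab : a ≤ b) :
    configSet {lengthVector ℓ a} ⊆ configSet (telescopicData ℓ a b) := by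
  refine preimage_mono (singleton_subset_iff.2 ?_)
  exact lengthVector_mem_telescopicData (left_mem_Icc.2 hab)

theorem exists_isQuotientManifold_fixed {m : ℕ} {ℓ : Fin m → ℝ} {a b : ℝ}
    (hℓ : ∀ i, 0 < ℓ i) (ha : 0 < a) (hab : a < b)
    (hdiff : b - a < bracket (lengthVector ℓ a))
    [ChartedSpace (EuclideanSpace ℝ (Fin (m - 2))) (armDirections ℓ a)]
    [IsManifold (𝓡 (m - 2)) ∞ (armDirections ℓ a)]
    (hι : ContMDiff (𝓡 (m - 2)) 𝓘(ℝ, Fin m → ℂ) ∞ (Subtype.val : armDirections ℓ a → Fin m → ℂ))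
    {ρ : (Fin m → ℂ) → armDirections ℓ a} (hρx : ∀ x : armDirections ℓ a, ρ x.1 = x)
    (hρs : ContMDiffOn 𝓘(ℝ, Fin m → ℂ) (𝓡 (m - 2)) ∞ ρ (armDirections ℓ a)) :
    ∃ _ : ChartedSpace (EuclideanSpace ℝ (Fin (m - 2))) (ModuliSpace {lengthVector ℓ a}),
      ModuliSpace.IsQuotientManifold {lengthVector ℓ a} (𝓡 (m - 2)) ∧
      Nonempty (ModuliSpace {lengthVector ℓ a} ≃ₘ^∞⟮𝓡 (m - 2), 𝓡 (m - 2)⟯ armDirections ℓ a) := by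
  have hsub := configSet_singleton_subset (ℓ := ℓ) hab.le
  have hρv : ∀ q ∈ armDirections ℓ a, (ρ q).1 = q := fun q hq => congrArg Subtype.val (hρx ⟨q, hq⟩)
  have hnorm : ContMDiffOn 𝓘(ℝ, Fin (m + 1) → ℂ) (𝓡 (m - 2)) ∞ (fun z => ρ (normalDirections ℓ a z))
      (configSet (telescopicData ℓ a b)) :=
    hρs.comp (contDiffOn_normalDirections hℓ ha hab.le hdiff).contMDiffOn
      fun z hz => normalDirections_mem hℓ ha hab.le hdiff hz
  have hnd := fun z (hz : z ∈ configSet (telescopicData ℓ a b)) =>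
    hρv _ (normalDirections_mem hℓ ha hab.le hdiff hz)
  have harm : ContMDiffOn 𝓘(ℝ, (Fin m → ℂ) × ℝ) 𝓘(ℝ, Fin (m + 1) → ℂ) ∞
      (fun p : (Fin m → ℂ) × ℝ => armConfig ℓ p.2 p.1) (armDirections ℓ a ×ˢ Icc a b) :=
    (contDiffOn_armConfig hℓ ha hdiff).contMDiffOn
  have haI := left_mem_Icc.2 hab.le
  exact ModuliSpace.exists_isQuotientManifold_of_section {lengthVector ℓ a}
    (𝓡 (m - 2)) (fun z => ρ (normalDirections ℓ a z))
    (fun x : armDirections ℓ a => armConfig ℓ a x.1) (hnorm.mono hsub)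
    (by
      have h1 : ContMDiff (𝓡 (m - 2)) 𝓘(ℝ, (Fin m → ℂ) × ℝ) ∞
          (fun x : armDirections ℓ a => (x.1, a)) := hι.prodMk_space contMDiff_const
      rw [← contMDiffOn_univ] at h1 ⊢
      exact harm.comp h1 fun x _ => ⟨x.2, haI⟩)
    (fun x => sideLengths_armConfig hℓ ha hdiff haI x.2)
    (fun z w hzw => by
      obtain ⟨ζ, c, hζ, h⟩ := (configSetoid_iff z w).1 hzw
      rw [normalDirections_motion hℓ ha hab.le hdiff hζ (hsub z.2) h])
    (fun x => by
      rw [normalDirections_armConfig hℓ ha hdiff haI x.2, hρx])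
    (fun z => by
      rw [configSetoid_iff]
      obtain ⟨ζ, c, hζ, h⟩ := exists_eq_armConfig hℓ ha hab.le hdiff (hsub z.2)
      refine ⟨ζ, c, hζ, fun i => ?_⟩
      have hz : sideLengths z.1 = lengthVector ℓ a := z.2
      change z.1 i = ζ * armConfig ℓ a (ρ (normalDirections ℓ a z.1)).1 i + c
      rw [hnd _ (hsub z.2), h i, hz, lengthVector_last])

theorem exists_isQuotientManifold_telescopic {m : ℕ} {ℓ : Fin m → ℝ} {a b : ℝ}
    (hℓ : ∀ i, 0 < ℓ i) (ha : 0 < a) (hab : a < b)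
    (hdiff : b - a < bracket (lengthVector ℓ a))
    [ChartedSpace (EuclideanSpace ℝ (Fin (m - 2))) (armDirections ℓ a)]
    [IsManifold (𝓡 (m - 2)) ∞ (armDirections ℓ a)]
    (hι : ContMDiff (𝓡 (m - 2)) 𝓘(ℝ, Fin m → ℂ) ∞ (Subtype.val : armDirections ℓ a → Fin m → ℂ))
    {ρ : (Fin m → ℂ) → armDirections ℓ a} (hρx : ∀ x : armDirections ℓ a, ρ x.1 = x)
    (hρs : ContMDiffOn 𝓘(ℝ, Fin m → ℂ) (𝓡 (m - 2)) ∞ ρ (armDirections ℓ a)) :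
    ∃ _ : ChartedSpace (ModelProd (EuclideanSpace ℝ (Fin (m - 2))) (EuclideanHalfSpace 1))
        (ModuliSpace (telescopicData ℓ a b)),
      ModuliSpace.IsQuotientManifold (telescopicData ℓ a b) ((𝓡 (m - 2)).prod (𝓡∂ 1)) ∧
      Nonempty (ModuliSpace (telescopicData ℓ a b)
        ≃ₘ^∞⟮(𝓡 (m - 2)).prod (𝓡∂ 1), (𝓡 (m - 2)).prod (𝓡∂ 1)⟯
        (armDirections ℓ a × Icc (0 : ℝ) 1)) := by
  have hba : 0 < b - a := sub_pos.2 hab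
  have hρv : ∀ q ∈ armDirections ℓ a, (ρ q).1 = q := fun q hq => congrArg Subtype.val (hρx ⟨q, hq⟩)
  have hnorm : ContMDiffOn 𝓘(ℝ, Fin (m + 1) → ℂ) (𝓡 (m - 2)) ∞ (fun z => ρ (normalDirections ℓ a z))
      (configSet (telescopicData ℓ a b)) :=
    hρs.comp (contDiffOn_normalDirections hℓ ha hab.le hdiff).contMDiffOn
      fun z hz => normalDirections_mem hℓ ha hab.le hdiff hz
  have hnd := fun z (hz : z ∈ configSet (telescopicData ℓ a b)) =>
    hρv _ (normalDirections_mem hℓ ha hab.le hdiff hz)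
  have harm : ContMDiffOn 𝓘(ℝ, (Fin m → ℂ) × ℝ) 𝓘(ℝ, Fin (m + 1) → ℂ) ∞
      (fun p : (Fin m → ℂ) × ℝ => armConfig ℓ p.2 p.1) (armDirections ℓ a ×ˢ Icc a b) :=
    (contDiffOn_armConfig hℓ ha hdiff).contMDiffOn
  -- The affine map from `[0, 1]` onto the range of the last length; `par` below inverts it.
  let leg : Icc (0 : ℝ) 1 → ℝ := fun τ => a + (b - a) * τ.1
  have hleg : ∀ τ, leg τ ∈ Icc a b := fun τ =>
    ⟨by nlinarith [τ.2.1], by nlinarith [τ.2.2]⟩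
  have hlegs : ContMDiff (𝓡∂ 1) 𝓘(ℝ, ℝ) ∞ leg := by
    have h1 : ContMDiff 𝓘(ℝ, ℝ) 𝓘(ℝ, ℝ) ∞ (fun τ : ℝ => a + (b - a) * τ) :=
      (contDiff_const.add (contDiff_const.mul contDiff_fun_id)).contMDiff
    exact h1.comp contMDiff_subtypeVal_Icc
  let par : (Fin (m + 1) → ℂ) → ℝ := fun z => (sideLengths z (Fin.last m) - a) / (b - a)
  have hpar : ∀ z ∈ configSet (telescopicData ℓ a b), par z ∈ Icc (0 : ℝ) 1 := by
    intro z hz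
    have := (mem_telescopicData_iff.1 hz).1
    exact ⟨div_nonneg (by linarith [this.1]) hba.le, (div_le_one hba).2 (by linarith [this.2])⟩
  have hpars : ContDiffOn ℝ ∞ par (configSet (telescopicData ℓ a b)) :=
    ((contDiffOn_sideLengths hℓ ha _).sub contDiffOn_const).div_const _
  have hlegpar : ∀ z (hz : z ∈ configSet (telescopicData ℓ a b)),
      leg (projIcc 0 1 zero_le_one (par z)) = sideLengths z (Fin.last m) := by
    intro z hz
    rw [projIcc_of_mem _ (hpar z hz)]
    simp only [leg, par]
    rw [mul_div_cancel₀ _ hba.ne']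
    ring
  have hQ : ContMDiffOn 𝓘(ℝ, Fin (m + 1) → ℂ) ((𝓡 (m - 2)).prod (𝓡∂ 1)) ∞
      (fun z => (ρ (normalDirections ℓ a z), projIcc (0 : ℝ) 1 zero_le_one (par z)))
      (configSet (telescopicData ℓ a b)) := by
    refine hnorm.prodMk ?_
    have h1 : ContMDiffOn 𝓘(ℝ, ℝ) (𝓡∂ 1) ∞ (projIcc (0 : ℝ) 1 zero_le_one) (Icc 0 1) :=
      contMDiffOn_projIcc
    exact h1.comp hpars.contMDiffOn hpar
  have hR : ContMDiff ((𝓡 (m - 2)).prod (𝓡∂ 1)) 𝓘(ℝ, Fin (m + 1) → ℂ) ∞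
      (fun x : armDirections ℓ a × Icc (0 : ℝ) 1 => armConfig ℓ (leg x.2) x.1.1) := by
    have h1 : ContMDiff ((𝓡 (m - 2)).prod (𝓡∂ 1)) 𝓘(ℝ, (Fin m → ℂ) × ℝ) ∞
        (fun x : armDirections ℓ a × Icc (0 : ℝ) 1 => (x.1.1, leg x.2)) :=
      (hι.comp contMDiff_fst).prodMk_space (hlegs.comp contMDiff_snd)
    rw [← contMDiffOn_univ] at h1 ⊢
    exact ContMDiffOn.comp (g := fun p : (Fin m → ℂ) × ℝ => armConfig ℓ p.2 p.1)
      (f := fun x : armDirections ℓ a × Icc (0 : ℝ) 1 => (x.1.1, leg x.2)) harm h1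
      fun x _ => ⟨x.1.2, hleg x.2⟩
  have hQR : ∀ x : armDirections ℓ a × Icc (0 : ℝ) 1,
      (ρ (normalDirections ℓ a (armConfig ℓ (leg x.2) x.1.1)),
        projIcc (0 : ℝ) 1 zero_le_one (par (armConfig ℓ (leg x.2) x.1.1))) = x := by
    intro x
    have hp : par (armConfig ℓ (leg x.2) x.1.1) = x.2.1 := by
      simp only [par]
      rw [sideLengths_armConfig hℓ ha hdiff (hleg x.2) x.1.2, lengthVector_last]
      simp only [leg]
      rw [add_sub_cancel_left, mul_div_cancel_left₀ _ hba.ne']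
    rw [normalDirections_armConfig hℓ ha hdiff (hleg x.2) x.1.2, hρx, hp, projIcc_val]
  have hRA : ∀ x : armDirections ℓ a × Icc (0 : ℝ) 1,
      armConfig ℓ (leg x.2) x.1.1 ∈ configSet (telescopicData ℓ a b) :=
    fun x => armConfig_mem hℓ ha hdiff (hleg x.2) x.1.2
  have hinv : ∀ z w : configSet (telescopicData ℓ a b), configSetoid (telescopicData ℓ a b) z w →
      (ρ (normalDirections ℓ a z.1), projIcc (0 : ℝ) 1 zero_le_one (par z.1)) =
      (ρ (normalDirections ℓ a w.1), projIcc (0 : ℝ) 1 zero_le_one (par w.1)) := by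
    intro z w hzw
    obtain ⟨ζ, c, hζ, h⟩ := (configSetoid_iff z w).1 hzw
    simp only [par]
    rw [normalDirections_motion hℓ ha hab.le hdiff hζ z.2 h, sideLengths_motion hζ h]
  clear_value leg par
  refine ModuliSpace.exists_isQuotientManifold_of_section (X := armDirections ℓ a × Icc (0 : ℝ) 1)
    (telescopicData ℓ a b) ((𝓡 (m - 2)).prod (𝓡∂ 1))
    (fun z => (ρ (normalDirections ℓ a z), projIcc (0 : ℝ) 1 zero_le_one (par z)))
    (fun x => armConfig ℓ (leg x.2) x.1.1) hQ hR hRA hinv hQR (fun z => ?_)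
  · rw [configSetoid_iff]
    obtain ⟨ζ, c, hζ, h⟩ := exists_eq_armConfig hℓ ha hab.le hdiff z.2
    refine ⟨ζ, c, hζ, fun i => ?_⟩
    simp only
    rw [hnd _ z.2, hlegpar _ z.2, h i]

theorem mainTheorem3 (m : ℕ) (ℓ : Fin m → ℝ) (a b : ℝ)
    (hℓ : ∀ i, 0 < ℓ i) (ha : 0 < a) (hab : a < b)
    (hgen_minus : IsGenericVector (lengthVector ℓ a))
    (hgen_plus : IsGenericVector (lengthVector ℓ b))
    (hdiff : b - a < bracket (lengthVector ℓ a)) :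
    ∃ (_ : ChartedSpace (EuclideanSpace ℝ (Fin (m - 2)))
          (ModuliSpace {lengthVector ℓ a}))
      (_ : ChartedSpace (ModelProd (EuclideanSpace ℝ (Fin (m - 2))) (EuclideanHalfSpace 1))
          (ModuliSpace (telescopicData ℓ a b))),
      ModuliSpace.IsQuotientManifold {lengthVector ℓ a} (𝓡 (m - 2)) ∧
      ModuliSpace.IsQuotientManifold (telescopicData ℓ a b) ((𝓡 (m - 2)).prod (𝓡∂ 1)) ∧
      Nonempty (ModuliSpace (telescopicData ℓ a b)
        ≃ₘ^∞⟮(𝓡 (m - 2)).prod (𝓡∂ 1), (𝓡 (m - 2)).prod (𝓡∂ 1)⟯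
        (ModuliSpace {lengthVector ℓ a} × Set.Icc (0 : ℝ) 1)) := by
  classical
  -- The retraction `ρ` needs a default value off the arm space. Without arms both moduli spaces are
  -- empty.
  rcases (armDirections ℓ a).eq_empty_or_nonempty with hN | ⟨q₀, hq₀⟩
  · have h1 : IsEmpty (configSet (telescopicData ℓ a b)) := ⟨fun z => by
      have := normalDirections_mem hℓ ha hab.le hdiff z.2
      simp [hN] at this⟩
    have h2 : IsEmpty (configSet {lengthVector ℓ a}) := ⟨fun z => h1.false ⟨z.1, configSet_singleton_subset hab.le z.2⟩⟩
    have h3 : IsEmpty (ModuliSpace (telescopicData ℓ a b)) := inferInstanceAs (IsEmpty (Quotient _))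
    have h4 : IsEmpty (ModuliSpace {lengthVector ℓ a}) := inferInstanceAs (IsEmpty (Quotient _))
    obtain ⟨c1, hc1⟩ := ModuliSpace.exists_isQuotientManifold_of_isEmpty
      {lengthVector ℓ a} (𝓡 (m - 2))
    obtain ⟨c2, hc2⟩ := ModuliSpace.exists_isQuotientManifold_of_isEmpty
      (telescopicData ℓ a b) ((𝓡 (m - 2)).prod (𝓡∂ 1))
    exact ⟨c1, c2, hc1, hc2, ⟨Diffeomorph.empty⟩⟩
  obtain ⟨cN, hmN, hι, hρ⟩ := exists_chartedSpace_armDirections hℓ ha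
    (sum_ne_of_isGenericVector hgen_minus)
  let ρ : (Fin m → ℂ) → armDirections ℓ a := fun q =>
    if h : q ∈ armDirections ℓ a then ⟨q, h⟩ else ⟨q₀, hq₀⟩
  have hρx : ∀ x : armDirections ℓ a, ρ x.1 = x := fun x => by simp [ρ]
  have hρs := hρ ρ hρx
  obtain ⟨c1, hc1, ⟨Φ⟩⟩ := exists_isQuotientManifold_fixed hℓ ha hab hdiff hι hρx hρs
  obtain ⟨c2, hc2, ⟨Ψ⟩⟩ := exists_isQuotientManifold_telescopic hℓ ha hab hdiff hι hρx hρs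
  exact ⟨c1, c2, hc1, hc2, ⟨Ψ.trans (Φ.symm.prodCongr (Diffeomorph.refl _ _ _))⟩⟩
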